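/- Let $G$ be a connected (finite-dimensional, real) Lie group with a left-invariant Lorentzian metric $\mu$, i.e. a left-invariant pseudo-Riemannian metric of signature $(-,+,\ldots,+)$, and suppose that $\mu$ is flat, i.e. the curvature of its Levi-Civita connection vanishes identically. Suppose that there is a left-invariant vector field $X$ on $G$ which is a Killing field for $\mu$ and is timelike, i.e. $\mu_p(X_p,X_p)<0$ for all $p\in G$. Then $G$ is $2$-step solvable (the second derived subgroup of $G$ is trivial: $[[G,G],[G,G]]=\{e\}$), $G$ is unimodular (its left Haar measure is also right-invariant), and $(G,\mu)$ is geodesically complete (for every $p\in G$ and $v\in T_pG$ there is a geodesic $\gamma:\mathbb{R}\to G$ with $\gamma(0)=p$ and $\gamma'(0)=v$). -/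

import Mathlib

open Bundle Manifold VectorField
open scoped ContDiff

noncomputable section

/-- A smooth Lorentzian metric on a manifold `M`: a smooth field of symmetric bilinear forms
on the tangent spaces, each of signature `(-, +, …, +)`. -/
structure LorentzianMetric {E : Type*} [NormedAddCommGroup E] [NormedSpace ℝ E]
    {H : Type*} [TopologicalSpace H] (I : ModelWithCorners ℝ E H)
    (M : Type*) [TopologicalSpace M] [ChartedSpace H M] [IsManifold I ∞ M] where
  /-- The bilinear form on each tangent space. -/
  inner (x : M) : TangentSpace I x →L[ℝ] TangentSpace I x →L[ℝ] ℝ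
  symm (x : M) (v w : TangentSpace I x) : inner x v w = inner x w v
  /-- Each tangent space has an orthonormal basis with exactly one negative vector. -/
  signature (x : M) : ∃ (n : ℕ) (b : Module.Basis (Fin (n + 1)) ℝ (TangentSpace I x)),
    ∀ i j, inner x (b i) (b j) = if i = j then (if i = 0 then -1 else 1) else 0
  contMDiff : ContMDiff I (I.prod 𝓘(ℝ, E →L[ℝ] E →L[ℝ] ℝ)) ∞
    (fun x ↦ TotalSpace.mk' (E →L[ℝ] E →L[ℝ] ℝ)
      (E := fun x : M ↦ TangentSpace I x →L[ℝ] TangentSpace I x →L[ℝ] ℝ) x (inner x))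

section Manifold

variable {E : Type*} [NormedAddCommGroup E] [NormedSpace ℝ E]
  {H : Type*} [TopologicalSpace H] {I : ModelWithCorners ℝ E H}
  {M : Type*} [TopologicalSpace M] [ChartedSpace H M] [IsManifold I ∞ M]

/-- `X` is a smooth vector field on `M`. -/
def IsSmoothVectorField (X : Π x : M, TangentSpace I x) : Prop :=
  ContMDiff I I.tangent ∞ (fun x ↦ (⟨x, X x⟩ : TangentBundle I M))

/-- The curvature of an affine connection vanishes:
`∇_X ∇_Y Z - ∇_Y ∇_X Z - ∇_[X,Y] Z = 0` for all smooth vector fields `X`, `Y`, `Z`.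
Recall that `∇_X Y` at `x` is written `cov Y x (X x)`. -/
def CurvatureVanishes (cov : CovariantDerivative I E (TangentSpace I : M → Type _)) : Prop :=
  ∀ X Y Z : Π x : M, TangentSpace I x,
    IsSmoothVectorField X → IsSmoothVectorField Y → IsSmoothVectorField Z → ∀ x : M,
      cov (fun y ↦ cov Z y (Y y)) x (X x) - cov (fun y ↦ cov Z y (X y)) x (Y x)
        - cov Z x (mlieBracket I X Y x) = 0

/-- The velocity `γ'(t)` of a curve. -/
def velocity (I : ModelWithCorners ℝ E H) (γ : ℝ → M) (t : ℝ) : TangentSpace I (γ t) :=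
  mfderiv 𝓘(ℝ, ℝ) I γ t (1 : ℝ)

/-- The vector field near `p` which extends `v : T_p M` and has constant components in the
coordinate frame of the preferred chart at `p`. -/
def constExtension {p : M} (v : TangentSpace I p) (x : M) : TangentSpace I x :=
  (trivializationAt E (TangentSpace I : M → Type _) p).symm x
    (trivializationAt E (TangentSpace I : M → Type _) p ⟨p, v⟩).2

/-- The covariant derivative at time `t` of a vector field `V` along a curve `γ`. In the coordinate
frame `(∂_k)` of the preferred chart at `γ t`, in which `V = ∑ V^k ∂_k`, it is
`∑ (V^k)'(t) ∂_k + ∑ V^k(t) ∇_{γ'(t)} ∂_k`. -/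
def covDerivAlong (cov : CovariantDerivative I E (TangentSpace I : M → Type _))
    (γ : ℝ → M) (V : Π t : ℝ, TangentSpace I (γ t)) (t : ℝ) : TangentSpace I (γ t) :=
  (trivializationAt E (TangentSpace I : M → Type _) (γ t)).symm (γ t)
      (deriv (fun s ↦ (trivializationAt E (TangentSpace I : M → Type _) (γ t) ⟨γ s, V s⟩).2) t)
    + cov (constExtension (V t)) (γ t) (velocity I γ t)

namespace LorentzianMetric

variable (μ : LorentzianMetric I M)

/-- `cov` is the Levi-Civita connection of `μ`: it is torsion-free,
`∇_X Y - ∇_Y X = [X, Y]`, and metric, `X μ(Y, Z) = μ(∇_X Y, Z) + μ(Y, ∇_X Z)`. These conditions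
determine `∇_v Y` for every tangent vector `v` and every differentiable vector field `Y`. -/
def IsLeviCivita (cov : CovariantDerivative I E (TangentSpace I : M → Type _)) : Prop :=
  (∀ X Y : Π x : M, TangentSpace I x, IsSmoothVectorField X → IsSmoothVectorField Y → ∀ x : M,
      cov Y x (X x) - cov X x (Y x) = mlieBracket I X Y x) ∧
  ∀ Y Z : Π x : M, TangentSpace I x, IsSmoothVectorField Y → IsSmoothVectorField Z →
    ∀ (x : M) (v : TangentSpace I x),
      mvfderiv I (fun y ↦ μ.inner y (Y y) (Z y)) x v
        = μ.inner x (cov Y x v) (Z x) + μ.inner x (Y x) (cov Z x v)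

/-- `μ` is flat: the curvature of its Levi-Civita connection vanishes. -/
def IsFlat : Prop :=
  ∃ cov : CovariantDerivative I E (TangentSpace I : M → Type _),
    μ.IsLeviCivita cov ∧ CurvatureVanishes cov

/-- `X` is timelike: `μ(X, X) < 0` at every point. -/
def IsTimelike (X : Π x : M, TangentSpace I x) : Prop :=
  ∀ x : M, μ.inner x (X x) (X x) < 0

/-- `X` is a Killing vector field: the Lie derivative `𝓛_X μ` vanishes, that is
`X μ(Y, Z) = μ([X, Y], Z) + μ(Y, [X, Z])` for all smooth vector fields `Y`, `Z`. -/
def IsKilling (X : Π x : M, TangentSpace I x) : Prop :=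
  IsSmoothVectorField X ∧
  ∀ Y Z : Π x : M, TangentSpace I x, IsSmoothVectorField Y → IsSmoothVectorField Z → ∀ x : M,
    mvfderiv I (fun y ↦ μ.inner y (Y y) (Z y)) x (X x)
      = μ.inner x (mlieBracket I X Y x) (Z x) + μ.inner x (Y x) (mlieBracket I X Z x)

/-- `γ : ℝ → M` is a geodesic defined on the whole real line: a smooth curve whose velocity is
parallel along it for the Levi-Civita connection. -/
def IsGeodesic (γ : ℝ → M) : Prop :=
  ContMDiff 𝓘(ℝ, ℝ) I ∞ γ ∧
  ∃ cov : CovariantDerivative I E (TangentSpace I : M → Type _),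
    μ.IsLeviCivita cov ∧ ∀ t : ℝ, covDerivAlong cov γ (velocity I γ) t = 0

/-- `μ` is geodesically complete: for every point `p` and every tangent vector `v` at `p` there is
a geodesic defined on the whole real line with initial point `p` and initial velocity `v`. -/
def IsGeodesicallyComplete : Prop :=
  ∀ (p : M) (v : TangentSpace I p), ∃ γ : ℝ → M, μ.IsGeodesic γ ∧
    (⟨γ 0, velocity I γ 0⟩ : TangentBundle I M) = ⟨p, v⟩

end LorentzianMetric

end Manifold

section LieGroup

variable {E : Type*} [NormedAddCommGroup E] [NormedSpace ℝ E]
  {H : Type*} [TopologicalSpace H] {I : ModelWithCorners ℝ E H}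
  {G : Type*} [TopologicalSpace G] [ChartedSpace H G] [Group G] [LieGroup I ∞ G]

/-- `μ` is left-invariant: all left translations are isometries. -/
def LorentzianMetric.IsLeftInvariant (μ : LorentzianMetric I G) : Prop :=
  ∀ (a x : G) (v w : TangentSpace I x),
    μ.inner (a * x) (mfderiv I I (fun y ↦ a * y) x v) (mfderiv I I (fun y ↦ a * y) x w)
      = μ.inner x v w

/-- `X` is a left-invariant vector field: `dL_a (X_x) = X_{a x}`. -/
def IsLeftInvariantVectorField (X : Π x : G, TangentSpace I x) : Prop :=
  ∀ a x : G, mfderiv I I (fun y ↦ a * y) x (X x) = X (a * x)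

variable (I G) in
/-- A finite-dimensional Lie group is unimodular if its modular character is trivial, that is, if
its left Haar measure is also right-invariant. -/
def IsUnimodularLieGroup [FiniteDimensional ℝ E] : Prop :=
  haveI : IsTopologicalGroup G := topologicalGroup_of_lieGroup I ∞
  haveI : LocallyCompactSpace G := Manifold.locallyCompact_of_finiteDimensional I
  ∀ g : G, MeasureTheory.Measure.modularCharacter g = 1

end LieGroup

end

/-!
Identify the Lie algebra of `G` with the model space `E`, let `B` be the metric at the identity and
let `L x y` be the value at the identity of `∇_X Y`, for the left-invariant fields `X`, `Y`
extending `x`, `y`. By the Koszul argument `∇_X Y` is again left-invariant (`covE_leftField`), so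
the geometry is the algebra of the product `L`: the operators `L x` are skew for `B`, vanishing
torsion says `[x, y] = L x y - L y x`, and flatness says that `x ↦ L x` respects brackets.

*From Lorentzian to Euclidean.* Let `x₀` be the value of the timelike Killing field at the identity.
The Killing equation makes `A : y ↦ L y x₀` skew for `B`; flatness and torsion-freeness show that
`A` commutes with all `L v`, whence `A² = 0`. As `A` takes values in the positive definite
hyperplane `x₀^⊥`, this forces `A = 0`, so the field is parallel. Changing the sign of `B` along
`x₀` gives an inner product `h` for which all `L x` are still skew (`exists_posDef_of_timelike`).

*Structure of flat Euclidean products.* Let `u = ker L`, and let `b` be its `h`-orthogonal. The form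
`-tr (L x ∘ L y)` is positive definite and `ad`-invariant on `b`; its Casimir element shows that `L`
vanishes on `b × b` (`flat_mul_eq_zero`). So `u` is an abelian ideal, `b` is an abelian subalgebra,
and `ad x = L x` is `h`-skew for `x ∈ b` (`IsFlatSplitting`, `exists_isFlatSplitting`).

*The group.* Write `exp` for the time-one map of one-parameter subgroups. As `G` is connected, it is
generated by `exp u` and `exp b`.
* `exp u` is an abelian normal subgroup with abelian quotient, so the second derived subgroup is
  trivial.
* For `x ∈ b` the map `Ad (exp x)` is an `h`-isometry of `u` and fixes `b`, so conjugation by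
  `exp x` preserves a compact neighbourhood of `1` and the modular character is `1` at `exp x`.
  On `exp u` it is `1` too: an element of `u` is the sum of one in the span of the
  `y - Ad (exp z) y`, `z ∈ b`, killed because the character is invariant under conjugation, and of
  one whose exponential is central.
* The curve `p exp (t x) exp (t y)`, `x ∈ u`, `y ∈ b`, has left logarithmic derivative
  `ξ t = Ad (exp (-t y)) x + y`, which solves the geodesic equation `ξ' = - L ξ ξ`. Every tangent
  vector at `p` is the initial velocity of one of these curves.
-/

noncomputable section

open Filter Topology
open scoped Pointwise

/-! ### Orthonormal bases of positive definite forms -/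

theorem exists_orthonormal_basis_of_posDef {W : Type*} [AddCommGroup W] [Module ℝ W]
    [FiniteDimensional ℝ W] (K : W →ₗ[ℝ] W →ₗ[ℝ] ℝ) (hsymm : ∀ x y, K x y = K y x)
    (hpos : ∀ x, x ≠ 0 → 0 < K x x) :
    ∃ (n : ℕ) (f : Module.Basis (Fin n) ℝ W), ∀ i j, K (f i) (f j) = if i = j then 1 else 0 := by
  let c : InnerProductSpace.Core ℝ W :=
    { inner := fun x y ↦ K x y
      conj_inner_symm := fun x y ↦ by simp [hsymm x y]
      re_inner_nonneg := fun x ↦ by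
        rcases eq_or_ne x 0 with rfl | hx
        · simp
        · simpa using (hpos x hx).le
      add_left := fun x y z ↦ by simp
      smul_left := fun x y r ↦ by simp
      definite := fun x hx ↦ by
        by_contra h
        exact (hpos x h).ne' hx }
  let _ : NormedAddCommGroup W := c.toNormedAddCommGroup
  let _ : InnerProductSpace ℝ W := InnerProductSpace.ofCore c.toCore
  let o := stdOrthonormalBasis ℝ W
  refine ⟨_, o.toBasis, fun i j ↦ ?_⟩
  have := (orthonormal_iff_ite.1 o.orthonormal) i j
  rw [OrthonormalBasis.coe_toBasis]
  exact this

theorem repr_eq_of_orthonormal {W : Type*} [AddCommGroup W] [Module ℝ W]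
    {K : W →ₗ[ℝ] W →ₗ[ℝ] ℝ} {n : ℕ} {f : Module.Basis (Fin n) ℝ W}
    (hf : ∀ i j, K (f i) (f j) = if i = j then 1 else 0) (x : W) (i : Fin n) :
    f.repr x i = K x (f i) := by
  have h : K x (f i) = K (∑ j, f.repr x j • f j) (f i) := by rw [f.sum_repr]
  rw [h]
  simp only [map_sum, map_smul, LinearMap.sum_apply, LinearMap.smul_apply, hf]
  simp

theorem eq_sum_of_orthonormal {W : Type*} [AddCommGroup W] [Module ℝ W]
    {K : W →ₗ[ℝ] W →ₗ[ℝ] ℝ} {n : ℕ} {f : Module.Basis (Fin n) ℝ W}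
    (hf : ∀ i j, K (f i) (f j) = if i = j then 1 else 0) (x : W) :
    x = ∑ i, K x (f i) • f i := by
  simp only [← repr_eq_of_orthonormal hf, f.sum_repr]

theorem exists_orthogonal_decomposition {W : Type*} [AddCommGroup W] [Module ℝ W]
    [FiniteDimensional ℝ W] {K : W →ₗ[ℝ] W →ₗ[ℝ] ℝ} (hsymm : ∀ x y, K x y = K y x)
    (hpos : ∀ x, x ≠ 0 → 0 < K x x) (U : Submodule ℝ W) (v : W) :
    ∃ w ∈ U, ∀ y ∈ U, K (v - w) y = 0 := by
  obtain ⟨m, f, hf⟩ := exists_orthonormal_basis_of_posDef (K.domRestrict₁₂ U U)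
    (fun x y ↦ hsymm x y) (fun x hx ↦ hpos x (by simpa using hx))
  have hf' : ∀ i j, K (f i) (f j) = if i = j then 1 else 0 := hf
  refine ⟨∑ i, K v (f i) • (f i : W), U.sum_mem fun i _ ↦ U.smul_mem _ (f i).2, fun y hy ↦ ?_⟩
  have h1 : ∀ j, K (v - ∑ i, K v (f i) • (f i : W)) (f j) = 0 := fun j ↦ by
    simp only [map_sub, map_sum, map_smul, LinearMap.sub_apply, LinearMap.sum_apply,
      LinearMap.smul_apply, hf']
    simp
  have h2 := congrArg U.subtype (f.sum_repr ⟨y, hy⟩)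
  simp only [map_sum, map_smul, Submodule.subtype_apply] at h2
  rw [← h2, map_sum]
  refine Finset.sum_eq_zero fun j _ ↦ ?_
  rw [map_smul, h1, smul_zero]

/-- The contraction `∑ T (f i) (f i)` over an orthonormal basis is invariant under the orthogonal
group of `K`; this is its infinitesimal form, for a skew map `D`. -/
theorem sum_contraction_eq_zero {W V : Type*} [AddCommGroup W] [Module ℝ W]
    [AddCommGroup V] [Module ℝ V]
    {K : W →ₗ[ℝ] W →ₗ[ℝ] ℝ} {n : ℕ} {f : Module.Basis (Fin n) ℝ W}
    (hsymm : ∀ x y, K x y = K y x)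
    (hf : ∀ i j, K (f i) (f j) = if i = j then 1 else 0)
    (T : W →ₗ[ℝ] W →ₗ[ℝ] V) (D : W → W) (hD : ∀ x y, K (D x) y = - K x (D y)) :
    ∑ i, (T (D (f i)) (f i) + T (f i) (D (f i))) = 0 := by
  have h1 : ∑ i, T (D (f i)) (f i) = ∑ i, ∑ j, K (D (f i)) (f j) • T (f j) (f i) := by
    refine Finset.sum_congr rfl fun i _ ↦ ?_
    conv_lhs => rw [eq_sum_of_orthonormal hf (D (f i))]
    simp
  have h2 : ∑ i, T (f i) (D (f i)) = ∑ i, ∑ j, K (D (f i)) (f j) • T (f i) (f j) := by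
    refine Finset.sum_congr rfl fun i _ ↦ ?_
    conv_lhs => rw [eq_sum_of_orthonormal hf (D (f i))]
    simp
  rw [Finset.sum_add_distrib, h1, h2, Finset.sum_comm, ← Finset.sum_add_distrib]
  refine Finset.sum_eq_zero fun i _ ↦ ?_
  rw [← Finset.sum_add_distrib]
  refine Finset.sum_eq_zero fun j _ ↦ ?_
  rw [hD (f j), hsymm (f j), neg_smul, neg_add_cancel]

/-! ### Flat torsion-free products with skew multiplications -/

section Euclidean

variable {V : Type*} [AddCommGroup V] [Module ℝ V]

theorem trace_sq_of_skew {h : V →ₗ[ℝ] V →ₗ[ℝ] ℝ} {n : ℕ} {f : Module.Basis (Fin n) ℝ V}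
    (hf : ∀ i j, h (f i) (f j) = if i = j then 1 else 0) (A : V →ₗ[ℝ] V)
    (hA : ∀ y z, h (A y) z = - h y (A z)) :
    LinearMap.trace ℝ V (A ∘ₗ A) = - ∑ i, h (A (f i)) (A (f i)) := by
  rw [LinearMap.trace_eq_matrix_trace ℝ f, Matrix.trace, ← Finset.sum_neg_distrib]
  refine Finset.sum_congr rfl fun i _ ↦ ?_
  simp only [Matrix.diag_apply, LinearMap.toMatrix_apply, LinearMap.comp_apply,
    repr_eq_of_orthonormal hf]
  exact hA _ _

/-- A flat product whose left multiplications are skew for an inner product `h` vanishes on the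
`h`-orthogonal `b` of `ker L`. The form `K x y = -tr (L x ∘ L y)` is positive definite on `b` and
invariant under `D x y = L x y - L y x`. For a `K`-orthonormal basis `f` of `b` and
`w = ∑ L (f i) (f i)`, invariance gives `L x w = C x` with the Casimir operator
`C = ∑ L (f i) ∘ L (f i)`, which is negative semidefinite with kernel `{v | ∀ x ∈ b, L x v = 0}`.
Since `h (L w w) w = 0`, the vector `w` lies in this kernel, so `C` vanishes on `b`. -/
theorem flat_mul_eq_zero [FiniteDimensional ℝ V] (h : V →ₗ[ℝ] V →ₗ[ℝ] ℝ)
    (hsymm : ∀ x y, h x y = h y x) (hpos : ∀ x, x ≠ 0 → 0 < h x x) (L : V →ₗ[ℝ] V →ₗ[ℝ] V)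
    (skew : ∀ x y z, h (L x y) z = - h y (L x z))
    (flat : ∀ x y, L (L x y - L y x) = L x ∘ₗ L y - L y ∘ₗ L x)
    {x y : V} (hx : ∀ u, L u = 0 → h u x = 0) (hy : ∀ u, L u = 0 → h u y = 0) :
    L x y = 0 := by
  have hnn : ∀ x, 0 ≤ h x x := fun x ↦ by
    rcases eq_or_ne x 0 with rfl | hx
    · simp
    · exact (hpos x hx).le
  have hdef : ∀ x, h x x = 0 → x = 0 := fun x hx ↦ by
    by_contra hne
    exact (hpos x hne).ne' hx
  obtain ⟨n, e, he⟩ := exists_orthonormal_basis_of_posDef h hsymm hpos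
  let b : Submodule ℝ V :=
    { carrier := {x | ∀ u, L u = 0 → h u x = 0}
      add_mem' := fun {p q} hp hq u hu ↦ by rw [map_add, hp u hu, hq u hu, add_zero]
      zero_mem' := fun u _ ↦ by simp
      smul_mem' := fun c p hp u hu ↦ by rw [map_smul, hp u hu, smul_zero] }
  have hker : ∀ x u, L u = 0 → L (L x u) = 0 := fun x u hu ↦ by
    have := flat x u
    simpa [hu] using this
  -- `b` is invariant under the `L x` because `ker L` is
  have hb : ∀ x, ∀ y ∈ b, L x y ∈ b := fun x y hy u hu ↦ by
    have := skew x u y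
    have h2 := hy _ (hker x u hu)
    linarith
  let K₀ : V →ₗ[ℝ] V →ₗ[ℝ] ℝ :=
    LinearMap.mk₂ ℝ (fun x y ↦ - LinearMap.trace ℝ V (L x * L y))
      (fun x x' y ↦ by simp [add_mul, add_comm]) (fun c x y ↦ by simp)
      (fun x y y' ↦ by simp [mul_add, add_comm]) (fun c x y ↦ by simp)
  have hK₀ : ∀ x y, K₀ x y = - LinearMap.trace ℝ V (L x * L y) := fun x y ↦ rfl
  let K : b →ₗ[ℝ] b →ₗ[ℝ] ℝ := K₀.domRestrict₁₂ b b
  have hK : ∀ x y : b, K x y = - LinearMap.trace ℝ V (L x * L y) := fun x y ↦ rfl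
  have Ksymm : ∀ x y, K x y = K y x := fun x y ↦ by
    rw [hK, hK, LinearMap.trace_mul_comm]
  -- `K x x` is the squared Hilbert-Schmidt norm of `L x`, and `b ∩ ker L = 0`
  have Kpos : ∀ x : b, x ≠ 0 → 0 < K x x := by
    intro x hx
    have h1 : K x x = ∑ i, h (L x (e i)) (L x (e i)) := by
      have := trace_sq_of_skew he (L x) (skew x)
      rw [hK]
      rw [← Module.End.mul_eq_comp] at this
      rw [this, neg_neg]
    rw [h1]
    refine lt_of_le_of_ne (Finset.sum_nonneg fun i _ ↦ hnn _) fun h0 ↦ hx ?_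
    have h2 := (Finset.sum_eq_zero_iff_of_nonneg (fun i _ ↦ hnn _)).1 h0.symm
    have h3 : L x = 0 := e.ext fun i ↦ by simpa using hdef _ (h2 i (Finset.mem_univ i))
    exact Subtype.ext (hdef _ (x.2 _ h3))
  obtain ⟨m, f, hf⟩ := exists_orthonormal_basis_of_posDef K Ksymm Kpos
  have flat' : ∀ x y z, L x (L y z) - L y (L x z) = L (L x y - L y x) z := fun x y z ↦ by
    rw [flat]; rfl
  let D : b → b → b := fun x y ↦ ⟨L x y - L y x, b.sub_mem (hb _ _ y.2) (hb _ _ x.2)⟩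
  have hD : ∀ x y z, K (D x y) z = - K y (D x z) := by
    intro x y z
    simp only [hK, D, flat, ← Module.End.mul_eq_comp, sub_mul, mul_sub, map_sub]
    have := LinearMap.trace_mul_comm ℝ (L x) (L y * L z)
    simp only [mul_assoc] at this ⊢
    rw [this]
    ring
  let T : b →ₗ[ℝ] b →ₗ[ℝ] V := L.domRestrict₁₂ b b
  let w : V := ∑ i, L (f i) (f i)
  have hw : ∀ x : b, L x w = ∑ i, L (f i) (L (f i) x) := by
    intro x
    have h0 := sum_contraction_eq_zero Ksymm hf T (D x) (hD x)
    have h1 : ∀ i, L x (L (f i) (f i)) = L (f i) (L (f i) x) +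
        (T (D x (f i)) (f i) + T (f i) (D x (f i))) := by
      intro i
      have h2 := flat' x (f i) (f i)
      have h3 : T (D x (f i)) (f i) = L (L x (f i) - L (f i) x) (f i) := rfl
      have h4 : T (f i) (D x (f i)) = L (f i) (L x (f i) - L (f i) x) := rfl
      rw [h3, h4, ← h2, map_sub]
      abel
    simp only [w, map_sum, h1, Finset.sum_add_distrib (f := fun i ↦ L (f i) (L (f i) x)), h0,
      add_zero]
  have hwb : w ∈ b := b.sum_mem fun i _ ↦ hb _ _ (f i).2
  have hcas : ∀ v, h (∑ i, L (f i) (L (f i) v)) v = 0 → ∀ x : b, L x v = 0 := by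
    intro v hv x
    have h1 : ∑ i, h (L (f i) v) (L (f i) v) = 0 := by
      simp only [map_sum, LinearMap.sum_apply, skew _ (L _ v) v, Finset.sum_neg_distrib] at hv
      linarith
    have h2 := (Finset.sum_eq_zero_iff_of_nonneg (fun i _ ↦ hnn _)).1 h1
    have h3 : ∀ i, L (f i) v = 0 := fun i ↦ hdef _ (h2 i (Finset.mem_univ i))
    have h4 := congrArg (fun y : b ↦ L y v) (f.sum_repr x)
    simp only [Submodule.coe_sum, Submodule.coe_smul, map_sum, map_smul, LinearMap.sum_apply,
      LinearMap.smul_apply, h3, smul_zero, Finset.sum_const_zero] at h4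
    exact h4.symm
  have hw0 : ∀ x : b, L x w = 0 := by
    refine hcas w ?_
    have h1 := hw ⟨w, hwb⟩
    have h2 := skew w w w
    rw [← h1]
    have h3 := hsymm (L w w) w
    change h (L w w) w = 0
    linarith
  have := hcas y (by rw [← hw ⟨y, hy⟩, hw0]; simp) ⟨x, hx⟩
  exact this

/-- The form is positive on the orthogonal of a timelike vector, by the Cauchy–Schwarz inequality
for the spacelike components. -/
theorem pos_of_orthogonal_timelike {B : V →ₗ[ℝ] V →ₗ[ℝ] ℝ} {n : ℕ}
    {f : Module.Basis (Fin (n + 1)) ℝ V}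
    (hf : ∀ i j, B (f i) (f j) = if i = j then (if i = 0 then -1 else 1) else 0)
    {x v : V} (hx : B x x < 0) (hv : B x v = 0) (hv0 : v ≠ 0) : 0 < B v v := by
  have key : ∀ p q, B p q = - (f.repr p 0 * f.repr q 0)
      + ∑ i : Fin n, f.repr p i.succ * f.repr q i.succ := by
    intro p q
    have h : B p q = B (∑ j, f.repr p j • f j) (∑ j, f.repr q j • f j) := by
      rw [f.sum_repr, f.sum_repr]
    rw [h]
    simp only [map_sum, map_smul, LinearMap.sum_apply, LinearMap.smul_apply, hf, smul_eq_mul,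
      mul_ite, mul_zero, Finset.sum_ite_eq', Finset.mem_univ, if_true]
    simp [Fin.sum_univ_succ, mul_comm]
  rw [key] at hx hv ⊢
  have cs := Finset.sum_mul_sq_le_sq_mul_sq Finset.univ (fun i : Fin n ↦ f.repr x i.succ)
    (fun i ↦ f.repr v i.succ)
  simp only [← pow_two] at hx ⊢
  set s := ∑ i : Fin n, f.repr x i.succ ^ 2
  set t := ∑ i : Fin n, f.repr v i.succ ^ 2
  set r := ∑ i : Fin n, f.repr x i.succ * f.repr v i.succ
  set a := f.repr x 0
  set c := f.repr v 0
  have hs : 0 ≤ s := Finset.sum_nonneg fun i _ ↦ sq_nonneg _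
  have ht : 0 ≤ t := Finset.sum_nonneg fun i _ ↦ sq_nonneg _
  have hr : r = a * c := by linarith
  by_contra hcon
  have h1 : t ≤ c ^ 2 := by linarith
  have h3 : a ^ 2 * c ^ 2 ≤ s * t := by rw [← mul_pow, ← hr]; exact cs
  have h4 : c = 0 := by
    by_contra hc
    have : 0 < c ^ 2 := by positivity
    nlinarith
  have h5 : t = 0 := by rw [h4] at h1; nlinarith
  have h6 := (Finset.sum_eq_zero_iff_of_nonneg (fun i _ ↦ sq_nonneg _)).1 h5
  refine hv0 (f.ext_elem fun i ↦ ?_)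
  refine Fin.cases ?_ (fun j ↦ ?_) i
  · simpa using h4
  · simpa using h6 j (Finset.mem_univ j)

/-- A flat product which is skew for a Lorentzian form `B`, and for which `ad x₀` is skew for some
timelike `x₀`, is skew for an inner product: `x₀` is parallel, and the inner product is `B` with the
sign along `x₀` reversed. -/
theorem exists_posDef_of_timelike (B : V →ₗ[ℝ] V →ₗ[ℝ] ℝ) (hsymm : ∀ x y, B x y = B y x)
    (L : V →ₗ[ℝ] V →ₗ[ℝ] V)
    (skew : ∀ x y z, B (L x y) z = - B y (L x z))
    (flat : ∀ x y, L (L x y - L y x) = L x ∘ₗ L y - L y ∘ₗ L x)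
    {x₀ : V} (hx₀ : B x₀ x₀ < 0) (hperp : ∀ v, B x₀ v = 0 → v ≠ 0 → 0 < B v v)
    (kill : ∀ y z, B (L x₀ y - L y x₀) z = - B y (L x₀ z - L z x₀)) :
    ∃ h : V →ₗ[ℝ] V →ₗ[ℝ] ℝ, (∀ x y, h x y = h y x) ∧ (∀ x, x ≠ 0 → 0 < h x x) ∧
      ∀ x y z, h (L x y) z = - h y (L x z) := by
  have hperp' : ∀ v, B x₀ v = 0 → B v v = 0 → v = 0 := fun v h1 h2 ↦ by
    by_contra h
    exact (hperp v h1 h).ne' h2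
  have decomp : ∀ v, ∃ (c : ℝ) (v' : V), B x₀ v' = 0 ∧ v = c • x₀ + v' := fun v ↦ by
    refine ⟨B x₀ v / B x₀ x₀, v - (B x₀ v / B x₀ x₀) • x₀, ?_, by abel⟩
    simp [hx₀.ne]
  have hnondeg : ∀ v, (∀ z, B v z = 0) → v = 0 := fun v hv ↦
    hperp' v (by rw [hsymm]; exact hv _) (hv v)
  -- the Killing equation in terms of `A : y ↦ L y x₀`
  have hA : ∀ y z, B (L y x₀) z = - B y (L z x₀) := fun y z ↦ by
    have h1 := kill y z
    have h2 := skew x₀ y z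
    simp only [map_sub, LinearMap.sub_apply] at h1
    linarith
  have hAx : ∀ y, B x₀ (L y x₀) = 0 := fun y ↦ by
    have h1 := skew y x₀ x₀
    have h2 := hsymm (L y x₀) x₀
    linarith
  have hxx : L x₀ x₀ = 0 := hnondeg _ fun z ↦ by
    rw [hA, hAx, neg_zero]
  -- `A` commutes with every `L v`
  have hpar : ∀ v w, L (L v w) x₀ = L v (L w x₀) := by
    have flat' : ∀ x y z, L x (L y z) - L y (L x z) = L (L x y - L y x) z := fun x y z ↦ by
      rw [flat]; rfl
    -- `B (L v (L w x₀) - L (L v w) x₀) z` is symmetric in `v, w` and skew in `w, z`, hence zero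
    have hS1 : ∀ v w, L v (L w x₀) - L (L v w) x₀ = L w (L v x₀) - L (L w v) x₀ := fun v w ↦ by
      have := flat' v w x₀
      simp only [map_sub, LinearMap.sub_apply] at this
      rw [sub_eq_sub_iff_add_eq_add] at this ⊢
      rw [add_comm, add_comm (L w (L v x₀)), add_comm, this.symm.trans (add_comm _ _), add_comm]
    have hS2 : ∀ v w z, B (L v (L w x₀) - L (L v w) x₀) z
        = - B (L v (L z x₀) - L (L v z) x₀) w := fun v w z ↦ by
      simp only [map_sub, LinearMap.sub_apply]
      have h1 := skew v (L w x₀) z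
      have h2 := hA w (L v z)
      have h3 := hA (L v w) z
      have h4 := skew v (L z x₀) w
      have h5 := hsymm (L (L v z) x₀) w
      have h6 := hsymm (L z x₀) (L v w)
      linarith
    intro v w
    symm
    rw [← sub_eq_zero]
    refine hnondeg _ fun z ↦ ?_
    have a1 := hS2 v w z
    have a2 := hS2 w z v
    have a3 := hS2 z v w
    rw [hS1 v w] at a1
    rw [hS1 w z] at a2
    rw [hS1 z v] at a3
    rw [hS1 v w]
    linarith
  -- `A² = 0`, so `A v` is a null vector orthogonal to `x₀`
  have hpx : ∀ v, L v x₀ = 0 := fun v ↦ by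
    refine hperp' _ (hAx v) ?_
    rw [hA, hpar, hxx]
    simp
  have hBL : ∀ x y, B x₀ (L x y) = 0 := fun x y ↦ by
    rw [hsymm, skew, hpx, map_zero, neg_zero]
  refine ⟨LinearMap.mk₂ ℝ (fun v w ↦ B v w - 2 / B x₀ x₀ * (B x₀ v * B x₀ w))
    (fun x x' y ↦ by simp only [map_add, LinearMap.add_apply]; ring)
    (fun c x y ↦ by simp only [map_smul, LinearMap.smul_apply, smul_eq_mul]; ring)
    (fun x y y' ↦ by simp only [map_add]; ring)
    (fun c x y ↦ by simp only [map_smul, smul_eq_mul]; ring), ?_, ?_, ?_⟩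
  · intro x y
    simp only [LinearMap.mk₂_apply, hsymm x y]
    ring
  · intro v hv
    obtain ⟨c, v', hv', rfl⟩ := decomp v
    have h1 : B v' x₀ = 0 := by rw [hsymm, hv']
    have h2 : LinearMap.mk₂ ℝ (fun v w ↦ B v w - 2 / B x₀ x₀ * (B x₀ v * B x₀ w))
      (fun x x' y ↦ by simp only [map_add, LinearMap.add_apply]; ring)
      (fun c x y ↦ by simp only [map_smul, LinearMap.smul_apply, smul_eq_mul]; ring)
      (fun x y y' ↦ by simp only [map_add]; ring)
      (fun c x y ↦ by simp only [map_smul, smul_eq_mul]; ring) (c • x₀ + v') (c • x₀ + v')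
        = - (c ^ 2 * B x₀ x₀) + B v' v' := by
      simp only [LinearMap.mk₂_apply, map_add, map_smul, LinearMap.add_apply, LinearMap.smul_apply,
        hv', h1, smul_eq_mul]
      field_simp
      ring
    rw [h2]
    rcases eq_or_ne v' 0 with rfl | hv'0
    · have hc : c ≠ 0 := by rintro rfl; simp at hv
      have : 0 < c ^ 2 := by positivity
      simp only [map_zero]
      nlinarith
    · nlinarith [hperp v' hv' hv'0, sq_nonneg c]
  · intro x y z
    simp only [LinearMap.mk₂_apply, hBL, skew x y z]
    ring

end Euclidean

/-! ### Derivatives between manifolds as linear maps of the model spaces -/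

section TangentDeriv

variable {E : Type*} [NormedAddCommGroup E] [NormedSpace ℝ E]
  {M : Type*} [TopologicalSpace M] [ChartedSpace E M]
  {E' : Type*} [NormedAddCommGroup E'] [NormedSpace ℝ E']
  {M' : Type*} [TopologicalSpace M'] [ChartedSpace E' M']
  {E'' : Type*} [NormedAddCommGroup E''] [NormedSpace ℝ E'']
  {M'' : Type*} [TopologicalSpace M''] [ChartedSpace E'' M'']

/-- The derivative of a map between manifolds modelled on `E` and `E'`, read as a linear map
`E → E'` through the preferred charts. It is `mfderiv` with all tangent spaces replaced by the model
spaces they are definitionally equal to. -/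
def tangentDeriv (E E' : Type*) [NormedAddCommGroup E] [NormedSpace ℝ E]
    [NormedAddCommGroup E'] [NormedSpace ℝ E'] {M M' : Type*} [TopologicalSpace M]
    [ChartedSpace E M] [TopologicalSpace M'] [ChartedSpace E' M'] (f : M → M') (x : M) :
    E →L[ℝ] E' :=
  mfderiv 𝓘(ℝ, E) 𝓘(ℝ, E') f x

theorem tangentDeriv_comp {g : M' → M''} {f : M → M'} {x : M}
    (hg : MDifferentiableAt 𝓘(ℝ, E') 𝓘(ℝ, E'') g (f x))
    (hf : MDifferentiableAt 𝓘(ℝ, E) 𝓘(ℝ, E') f x) :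
    tangentDeriv E E'' (g ∘ f) x = (tangentDeriv E' E'' g (f x)).comp (tangentDeriv E E' f x) :=
  mfderiv_comp x hg hf

theorem tangentDeriv_id (x : M) : tangentDeriv E E (id : M → M) x = ContinuousLinearMap.id ℝ E :=
  mfderiv_id

theorem tangentDeriv_eq_fderiv (f : E → E') (x : E) : tangentDeriv E E' f x = fderiv ℝ f x :=
  mfderiv_eq_fderiv

theorem tangentDeriv_extChartAt_self [IsManifold 𝓘(ℝ, E) 1 M] (x : M) :
    tangentDeriv E E (extChartAt 𝓘(ℝ, E) x) x = ContinuousLinearMap.id ℝ E := by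
  have h := mfderiv_chartAt_eq_tangentCoordChange (I := 𝓘(ℝ, E)) (mem_chart_source E x)
  ext v
  have h2 := congrArg (fun B : E →L[ℝ] E ↦ B v) h
  refine Eq.trans h2 ?_
  exact tangentCoordChange_self (mem_extChartAt_source x)

/-- The curve `c` is differentiable at `t` with velocity `v`, an element of the tangent space at
`c t`, which is identified with the model space. -/
def HasVelocityAt (c : ℝ → M) (v : E) (t : ℝ) : Prop :=
  HasMFDerivAt 𝓘(ℝ, ℝ) 𝓘(ℝ, E) c t ((1 : ℝ →L[ℝ] ℝ).smulRight v : ℝ →L[ℝ] E)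

theorem HasVelocityAt.comp {f : M → M'} {c : ℝ → M} {v : E} {t : ℝ}
    (hf : MDifferentiableAt 𝓘(ℝ, E) 𝓘(ℝ, E') f (c t)) (hc : HasVelocityAt c v t) :
    HasVelocityAt (fun s ↦ f (c s)) (tangentDeriv E E' f (c t) v) t := by
  have h := hf.hasMFDerivAt.comp t hc
  have e : (tangentDeriv E E' f (c t)).comp ((1 : ℝ →L[ℝ] ℝ).smulRight v : ℝ →L[ℝ] E)
      = (1 : ℝ →L[ℝ] ℝ).smulRight (tangentDeriv E E' f (c t) v) := by
    ext; simp
  exact h.congr_mfderiv e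

theorem hasVelocityAt_iff_hasDerivAt {c : ℝ → E} {v : E} {t : ℝ} :
    HasVelocityAt c v t ↔ HasDerivAt c v t := by
  rw [hasDerivAt_iff_hasFDerivAt, ← ContinuousLinearMap.smulRight_one_eq_toSpanSingleton]
  exact hasMFDerivAt_iff_hasFDerivAt

theorem HasVelocityAt.unique {c : ℝ → M} {v w : E} {t : ℝ} (h1 : HasVelocityAt c v t)
    (h2 : HasVelocityAt c w t) : v = w := by
  have h : ((1 : ℝ →L[ℝ] ℝ).smulRight v : ℝ →L[ℝ] E) = (1 : ℝ →L[ℝ] ℝ).smulRight w :=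
    hasMFDerivAt_unique h1 h2
  simpa using congrArg (fun f : ℝ →L[ℝ] E ↦ f 1) h

theorem HasVelocityAt.scomp {c : ℝ → M} {v : E} {t : ℝ} {f : ℝ → ℝ} {f' : ℝ}
    (hc : HasVelocityAt c v (f t)) (hf : HasDerivAt f f' t) :
    HasVelocityAt (fun s ↦ c (f s)) (f' • v) t := by
  have h := HasMFDerivAt.comp t hc hf.hasFDerivAt.hasMFDerivAt
  have e : ((1 : ℝ →L[ℝ] ℝ).smulRight v : ℝ →L[ℝ] E).comp
      (ContinuousLinearMap.toSpanSingleton ℝ f') = (1 : ℝ →L[ℝ] ℝ).smulRight (f' • v) := by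
    ext; simp
  exact h.congr_mfderiv e

end TangentDeriv

/-! ### Translations and the adjoint representation of a Lie group -/

section LieGroupCalculus

variable {E : Type*} [NormedAddCommGroup E] [NormedSpace ℝ E]
  {G : Type*} [TopologicalSpace G] [ChartedSpace E G] [Group G] [LieGroup 𝓘(ℝ, E) ∞ G]

/-- Mathlib states its results on left-invariant vector fields with this smoothness. -/
instance lieGroup_minSmoothness_three : LieGroup 𝓘(ℝ, E) (minSmoothness ℝ 3) G := by
  rw [minSmoothness_of_isRCLikeNormedField]
  infer_instance

theorem mdifferentiable_mul_left' (a : G) : MDifferentiable 𝓘(ℝ, E) 𝓘(ℝ, E) (fun h : G ↦ a * h) :=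
  (contMDiff_mul_left (I := 𝓘(ℝ, E)) (n := ∞)).mdifferentiable (by simp)

theorem mdifferentiable_mul_right' (a : G) : MDifferentiable 𝓘(ℝ, E) 𝓘(ℝ, E) (fun h : G ↦ h * a) :=
  (contMDiff_mul_right (I := 𝓘(ℝ, E)) (n := ∞)).mdifferentiable (by simp)

/-- The derivative at the identity of left multiplication by `g`; it sends `v` to the value at `g`
of the left-invariant vector field extending `v`. -/
def leftTranslate (g : G) : E →L[ℝ] E := tangentDeriv E E (fun h : G ↦ g * h) 1

theorem tangentDeriv_mul_left (a b : G) (v : E) :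
    tangentDeriv E E (fun h : G ↦ a * h) b (leftTranslate b v) = leftTranslate (a * b) v := by
  have h1 : (fun h ↦ a * b * h) = (fun h ↦ a * h) ∘ (fun h : G ↦ b * h) := by
    ext h; simp [mul_assoc]
  unfold leftTranslate
  rw [h1, tangentDeriv_comp (mdifferentiable_mul_left' a _) (mdifferentiable_mul_left' b _)]
  simp only [mul_one, ContinuousLinearMap.comp_apply]

omit [LieGroup 𝓘(ℝ, E) ∞ G] in
variable (E G) in
theorem leftTranslate_one : leftTranslate (1 : G) = ContinuousLinearMap.id ℝ E := by
  unfold leftTranslate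
  have : (fun h : G ↦ 1 * h) = id := by ext h; simp
  rw [this, tangentDeriv_id]

theorem leftTranslate_bijective (g : G) : Function.Bijective (leftTranslate (E := E) g) := by
  have h1 : ∀ v : E, tangentDeriv E E (fun h : G ↦ g⁻¹ * h) g (leftTranslate g v) = v := fun v ↦ by
    rw [tangentDeriv_mul_left, inv_mul_cancel, leftTranslate_one]; rfl
  have h2 : ∀ w : E, leftTranslate g (tangentDeriv E E (fun h : G ↦ g⁻¹ * h) g w) = w := fun w ↦ by
    have e : (fun h : G ↦ g * h) ∘ (fun h : G ↦ g⁻¹ * h) = id := by ext; simp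
    have := tangentDeriv_comp (mdifferentiable_mul_left' (E := E) g (g⁻¹ * g))
      (mdifferentiable_mul_left' (E := E) g⁻¹ g)
    rw [e, tangentDeriv_id, inv_mul_cancel] at this
    exact (congrArg (fun f : E →L[ℝ] E ↦ f w) this).symm
  exact ⟨Function.LeftInverse.injective h1, Function.RightInverse.surjective h2⟩

/-- The adjoint representation of a Lie group on its Lie algebra, the tangent space at the identity,
identified with the model space. -/
def adjointMap (g : G) : E →L[ℝ] E := tangentDeriv E E (fun h : G ↦ g * h * g⁻¹) 1

theorem mdifferentiable_conj (g : G) :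
    MDifferentiable 𝓘(ℝ, E) 𝓘(ℝ, E) (fun h : G ↦ g * h * g⁻¹) :=
  (mdifferentiable_mul_right' g⁻¹).comp (mdifferentiable_mul_left' g)

omit [LieGroup 𝓘(ℝ, E) ∞ G] in
theorem adjointMap_one (v : E) : adjointMap (1 : G) v = v := by
  have : (fun h : G ↦ 1 * h * 1⁻¹) = id := by ext h; simp
  unfold adjointMap
  rw [this, tangentDeriv_id]
  rfl

theorem adjointMap_mul (g k : G) (v : E) :
    adjointMap (g * k) v = adjointMap g (adjointMap k v) := by
  have h1 : (fun h ↦ g * k * h * (g * k)⁻¹)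
      = (fun h ↦ g * h * g⁻¹) ∘ (fun h : G ↦ k * h * k⁻¹) := by
    ext h; simp [mul_assoc]
  unfold adjointMap
  rw [h1, tangentDeriv_comp (mdifferentiable_conj g _) (mdifferentiable_conj k _)]
  simp

theorem tangentDeriv_mul_right (a b : G) (v : E) :
    tangentDeriv E E (fun h : G ↦ h * b) a (leftTranslate a v)
      = leftTranslate (a * b) (adjointMap b⁻¹ v) := by
  have h1 : (fun h ↦ h * b) ∘ (fun h ↦ a * h)
      = (fun h ↦ a * b * h) ∘ (fun h : G ↦ b⁻¹ * h * b⁻¹⁻¹) := by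
    ext h; simp [mul_assoc]
  unfold leftTranslate adjointMap
  have h2 : tangentDeriv E E ((fun h ↦ h * b) ∘ (fun h ↦ a * h)) 1
    = tangentDeriv E E ((fun h ↦ a * b * h) ∘ (fun h : G ↦ b⁻¹ * h * b⁻¹⁻¹)) 1 := by rw [h1]
  rw [tangentDeriv_comp (mdifferentiable_mul_right' b _) (mdifferentiable_mul_left' a _),
    tangentDeriv_comp (mdifferentiable_mul_left' _ _) (mdifferentiable_conj _ _)] at h2
  have h3 : b⁻¹ * 1 * b⁻¹⁻¹ = 1 := by simp
  rw [h3, mul_one] at h2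
  exact congrArg (fun f : E →L[ℝ] E ↦ f v) h2

/-- The curve `c` is differentiable at `t` with left logarithmic derivative `ξ`: its velocity is the
left translate of `ξ` to `c t`. -/
def HasLeftDerivAt (c : ℝ → G) (ξ : E) (t : ℝ) : Prop :=
  HasVelocityAt c (leftTranslate (c t) ξ) t

/-- The derivative of the multiplication of a Lie group. -/
def mulDeriv (a b : G) : E × E →L[ℝ] E :=
  mfderiv (𝓘(ℝ, E).prod 𝓘(ℝ, E)) 𝓘(ℝ, E) (fun p : G × G ↦ p.1 * p.2) (a, b)

theorem mulDeriv_apply (a b : G) (u v : E) :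
    mulDeriv a b (u, v) = tangentDeriv E E (fun h : G ↦ h * b) a u
      + tangentDeriv E E (fun h : G ↦ a * h) b v :=
  mfderiv_prod_eq_add_apply (v := ((u, v) : E × E))
    ((contMDiff_mul 𝓘(ℝ, E) ∞).mdifferentiable (by simp) (a, b))

theorem HasVelocityAt.mul {c d : ℝ → G} {ξ η : E} {t : ℝ} (hc : HasVelocityAt c ξ t)
    (hd : HasVelocityAt d η t) :
    HasVelocityAt (fun s ↦ c s * d s) (tangentDeriv E E (fun h : G ↦ h * d t) (c t) ξ
      + tangentDeriv E E (fun h : G ↦ c t * h) (d t) η) t := by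
  have hm : HasMFDerivAt (𝓘(ℝ, E).prod 𝓘(ℝ, E)) 𝓘(ℝ, E) (fun p : G × G ↦ p.1 * p.2) (c t, d t)
      (mulDeriv (c t) (d t)) :=
    ((contMDiff_mul 𝓘(ℝ, E) ∞).mdifferentiable (by simp) _).hasMFDerivAt
  have e : mulDeriv (c t) (d t) ∘L (((1 : ℝ →L[ℝ] ℝ).smulRight ξ : ℝ →L[ℝ] E).prod
      ((1 : ℝ →L[ℝ] ℝ).smulRight η)) = (1 : ℝ →L[ℝ] ℝ).smulRight
      (tangentDeriv E E (fun h : G ↦ h * d t) (c t) ξ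
        + tangentDeriv E E (fun h : G ↦ c t * h) (d t) η) := by
    ext
    simp [mulDeriv_apply]
  exact (hm.comp t (HasMFDerivAt.prodMk hc hd)).congr_mfderiv e

theorem HasLeftDerivAt.mul {c d : ℝ → G} {ξ η : E} {t : ℝ} (hc : HasLeftDerivAt c ξ t)
    (hd : HasLeftDerivAt d η t) :
    HasLeftDerivAt (fun s ↦ c s * d s) (adjointMap (d t)⁻¹ ξ + η) t := by
  have h := HasVelocityAt.mul hc hd
  rw [tangentDeriv_mul_left, tangentDeriv_mul_right, ← map_add] at h
  exact h

theorem HasLeftDerivAt.conj {c : ℝ → G} {ξ : E} {t : ℝ} (hc : HasLeftDerivAt c ξ t) (g : G) :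
    HasLeftDerivAt (fun s ↦ g * c s * g⁻¹) (adjointMap g ξ) t := by
  have h := HasVelocityAt.comp (mdifferentiable_mul_right' g⁻¹ _)
    (HasVelocityAt.comp (mdifferentiable_mul_left' g _) hc)
  rw [tangentDeriv_mul_left, tangentDeriv_mul_right, inv_inv] at h
  exact h

theorem HasLeftDerivAt.mul_left {c : ℝ → G} {ξ : E} {t : ℝ} (hc : HasLeftDerivAt c ξ t) (g : G) :
    HasLeftDerivAt (fun s ↦ g * c s) ξ t := by
  have h := HasVelocityAt.comp (mdifferentiable_mul_left' g _) hc
  rw [tangentDeriv_mul_left] at h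
  exact h

theorem contMDiff_leftTranslate (v : E) :
    ContMDiff 𝓘(ℝ, E) 𝓘(ℝ, E).tangent ∞
      (fun g : G ↦ (⟨g, leftTranslate (E := E) g v⟩ : TangentBundle 𝓘(ℝ, E) G)) := by
  let fg : G → TangentBundle 𝓘(ℝ, E) G := fun g ↦ TotalSpace.mk' E g 0
  have sfg : ContMDiff 𝓘(ℝ, E) 𝓘(ℝ, E).tangent ∞ fg := contMDiff_zeroSection _ _
  let fv : G → TangentBundle 𝓘(ℝ, E) G := fun _ ↦ TotalSpace.mk' E 1 v
  have sfv : ContMDiff 𝓘(ℝ, E) 𝓘(ℝ, E).tangent ∞ fv := contMDiff_const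
  have S₁ : ContMDiff 𝓘(ℝ, E) _ ∞ (fun g ↦ (fg g, fv g)) := sfg.prodMk sfv
  have S₂ : ContMDiff _ _ ∞ (equivTangentBundleProd 𝓘(ℝ, E) G 𝓘(ℝ, E) G).symm :=
    contMDiff_equivTangentBundleProd_symm
  have S₃ : ContMDiff _ _ ∞ (tangentMap (𝓘(ℝ, E).prod 𝓘(ℝ, E)) 𝓘(ℝ, E)
      (fun (p : G × G) ↦ p.1 * p.2)) :=
    ContMDiff.contMDiff_tangentMap (contMDiff_mul 𝓘(ℝ, E) ∞) (by simp)
  have S := (S₃.comp S₂).comp S₁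
  refine S.congr fun g ↦ ?_
  have e : leftTranslate g v = mulDeriv g 1 (0, v) := by
    rw [mulDeriv_apply, map_zero, zero_add]; rfl
  rw [e]
  have h1 : (⟨g * 1, mulDeriv (E := E) g 1 (0, v)⟩ : TangentBundle 𝓘(ℝ, E) G)
      = ⟨g, mulDeriv (E := E) g 1 (0, v)⟩ := by rw [mul_one]
  exact h1.symm

end LieGroupCalculus

/-! ### The multiplication in the chart at the identity -/

section MulChart

variable {E : Type*} [NormedAddCommGroup E] [NormedSpace ℝ E]

/-- Integral curves of a smooth field are smooth. -/
theorem contDiffOn_of_hasDerivAt_of_contDiffOn {F : E → E} {W : Set E} (hF : ContDiffOn ℝ ∞ F W)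
    {p : ℝ → E} {J : Set ℝ} (hJ : IsOpen J) (hW : Set.MapsTo p J W)
    (hp : ∀ t ∈ J, HasDerivAt p (F (p t)) t) : ContDiffOn ℝ ∞ p J := by
  rw [contDiffOn_infty]
  intro n
  induction n with
  | zero =>
    exact contDiffOn_zero.2 fun t ht ↦ (hp t ht).continuousAt.continuousWithinAt
  | succ n ih =>
    have : ((n + 1 : ℕ) : ℕ∞ω) = (n : ℕ∞ω) + 1 := by push_cast; rfl
    rw [this, contDiffOn_succ_iff_deriv_of_isOpen hJ]
    refine ⟨fun t ht ↦ (hp t ht).differentiableAt.differentiableWithinAt, by simp, ?_⟩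
    refine ((hF.of_le (by exact_mod_cast le_top)).comp ih hW).congr fun t ht ↦ (hp t ht).deriv

variable {G : Type*} [TopologicalSpace G] [ChartedSpace E G] [Group G] [LieGroup 𝓘(ℝ, E) ∞ G]

/-- The chart at the identity. -/
local notation "φ" => extChartAt 𝓘(ℝ, E) (1 : G)

variable (E G) in
/-- The multiplication of a Lie group, in the preferred chart at the identity. -/
def mulChart (p : E × E) : E := φ ((φ).symm p.1 * (φ).symm p.2)

theorem contMDiffAt_chart_symm {q : E} (hq : q ∈ (φ).target) :
    ContMDiffAt 𝓘(ℝ, E) 𝓘(ℝ, E) ∞ (φ).symm q :=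
  (contMDiffOn_extChartAt_symm (1 : G)).contMDiffAt ((isOpen_extChartAt_target 1).mem_nhds hq)

theorem mdifferentiableAt_chart_symm {q : E} (hq : q ∈ (φ).target) :
    MDifferentiableAt 𝓘(ℝ, E) 𝓘(ℝ, E) (φ).symm q :=
  (contMDiffAt_chart_symm hq).mdifferentiableAt (by simp)

theorem contMDiffAt_chart {g : G} (hg : g ∈ (φ).source) :
    ContMDiffAt 𝓘(ℝ, E) 𝓘(ℝ, E) ∞ (φ) g :=
  contMDiffAt_extChartAt' (by simpa using hg)

theorem mdifferentiableAt_chart {g : G} (hg : g ∈ (φ).source) :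
    MDifferentiableAt 𝓘(ℝ, E) 𝓘(ℝ, E) (φ) g :=
  (contMDiffAt_chart hg).mdifferentiableAt (by simp)

theorem contDiffAt_mulChart {q r : E} (hq : q ∈ (φ).target) (hr : r ∈ (φ).target)
    (hqr : (φ).symm q * (φ).symm r ∈ (φ).source) : ContDiffAt ℝ ∞ (mulChart E G) (q, r) := by
  rw [← contMDiffAt_iff_contDiffAt]
  have h1 : ContMDiffAt 𝓘(ℝ, E × E) 𝓘(ℝ, E) ∞ (fun p : E × E ↦ (φ).symm p.1) (q, r) :=
    ContMDiffAt.comp (q, r) (contMDiffAt_chart_symm hq) contDiff_fst.contMDiff.contMDiffAt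
  have h2 : ContMDiffAt 𝓘(ℝ, E × E) 𝓘(ℝ, E) ∞ (fun p : E × E ↦ (φ).symm p.2) (q, r) :=
    ContMDiffAt.comp (q, r) (contMDiffAt_chart_symm hr) contDiff_snd.contMDiff.contMDiffAt
  exact ContMDiffAt.comp (q, r) (contMDiffAt_chart hqr) (h1.mul h2)

theorem tangentDeriv_chart_symm :
    tangentDeriv E E (φ).symm ((φ) 1) = ContinuousLinearMap.id ℝ E := by
  have ht : (φ) 1 ∈ (φ).target := mem_extChartAt_target 1
  have h1 : (φ).symm ((φ) 1) = 1 := extChartAt_to_inv 1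
  have h := tangentDeriv_comp (g := φ) (f := (φ).symm) (x := (φ) 1)
    (mdifferentiableAt_chart (by rw [h1]; exact mem_extChartAt_source 1))
    (mdifferentiableAt_chart_symm ht)
  rw [h1, tangentDeriv_extChartAt_self, tangentDeriv_eq_fderiv] at h
  have h2 : (φ ∘ (φ).symm) =ᶠ[𝓝 ((φ) 1)] id := by
    filter_upwards [(isOpen_extChartAt_target (I := 𝓘(ℝ, E)) (1 : G)).mem_nhds ht] with q hq
    exact (φ).right_inv hq
  rw [h2.fderiv_eq, fderiv_id] at h
  exact h.symm

omit [LieGroup 𝓘(ℝ, E) ∞ G] in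
theorem chart_one_mem_target : (φ) 1 ∈ (φ).target := mem_extChartAt_target 1

theorem contDiffAt_mulChart_left {g : G} (hg : g ∈ (φ).source) :
    ContDiffAt ℝ ∞ (mulChart E G) ((φ) g, (φ) 1) :=
  contDiffAt_mulChart ((φ).map_source hg) chart_one_mem_target
    (by rwa [(φ).left_inv hg, extChartAt_to_inv, mul_one])

theorem contDiffAt_mulChart_right {g : G} (hg : g ∈ (φ).source) :
    ContDiffAt ℝ ∞ (mulChart E G) ((φ) 1, (φ) g) :=
  contDiffAt_mulChart chart_one_mem_target ((φ).map_source hg)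
    (by rwa [(φ).left_inv hg, extChartAt_to_inv, one_mul])

theorem fderiv_mulChart_left {g : G} (hg : g ∈ (φ).source) (v : E) :
    fderiv ℝ (mulChart E G) ((φ) g, (φ) 1) (0, v) = tangentDeriv E E (φ) g (leftTranslate g v) := by
  have h1 : HasFDerivAt (mulChart E G) (fderiv ℝ (mulChart E G) ((φ) g, (φ) 1)) ((φ) g, (φ) 1) :=
    ((contDiffAt_mulChart_left hg).differentiableAt (by simp)).hasFDerivAt
  have h2 : HasFDerivAt (fun r ↦ mulChart E G ((φ) g, r)) _ ((φ) 1) :=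
    HasFDerivAt.comp (f := fun r ↦ ((φ) g, r)) (g := mulChart E G) ((φ) 1) h1
      ((hasFDerivAt_const ((φ) g) ((φ) 1)).prodMk (hasFDerivAt_id ((φ) 1)))
  have h3 : (fun r ↦ mulChart E G ((φ) g, r)) = (φ ∘ (fun h ↦ g * h)) ∘ (φ).symm := by
    ext r
    simp only [mulChart, Function.comp_apply, (φ).left_inv hg]
  have h4 : (φ).symm ((φ) 1) = 1 := extChartAt_to_inv 1
  have hg1 : (φ) 1 ∈ (φ).target := chart_one_mem_target
  have h5 : tangentDeriv E E ((φ ∘ (fun h ↦ g * h)) ∘ (φ).symm) ((φ) 1)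
      = (tangentDeriv E E (φ) g).comp (leftTranslate g) := by
    rw [tangentDeriv_comp (E' := E), tangentDeriv_chart_symm, h4, tangentDeriv_comp (E' := E),
      mul_one, ContinuousLinearMap.comp_id]
    · rfl
    · exact mdifferentiableAt_chart (by simpa using hg)
    · exact mdifferentiable_mul_left' g 1
    · rw [h4]
      exact (mdifferentiableAt_chart (by simpa using hg)).comp _ (mdifferentiable_mul_left' g 1)
    · exact mdifferentiableAt_chart_symm hg1
  rw [h3] at h2
  rw [tangentDeriv_eq_fderiv, h2.fderiv] at h5
  simpa using congrArg (fun f : E →L[ℝ] E ↦ f v) h5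

theorem fderiv_mulChart_right {g : G} (hg : g ∈ (φ).source) (v : E) :
    fderiv ℝ (mulChart E G) ((φ) 1, (φ) g) (v, 0)
      = tangentDeriv E E (φ) g (leftTranslate g (adjointMap g⁻¹ v)) := by
  have h1 : HasFDerivAt (mulChart E G) (fderiv ℝ (mulChart E G) ((φ) 1, (φ) g)) ((φ) 1, (φ) g) :=
    ((contDiffAt_mulChart_right hg).differentiableAt (by simp)).hasFDerivAt
  have h2 : HasFDerivAt (fun r ↦ mulChart E G (r, (φ) g)) _ ((φ) 1) :=
    HasFDerivAt.comp (f := fun r ↦ (r, (φ) g)) (g := mulChart E G) ((φ) 1) h1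
      ((hasFDerivAt_id ((φ) 1)).prodMk (hasFDerivAt_const ((φ) g) ((φ) 1)))
  have h3 : (fun r ↦ mulChart E G (r, (φ) g)) = (φ ∘ (fun h ↦ h * g)) ∘ (φ).symm := by
    ext r
    simp only [mulChart, Function.comp_apply, (φ).left_inv hg]
  have h4 : (φ).symm ((φ) 1) = 1 := extChartAt_to_inv 1
  have hg1 : (φ) 1 ∈ (φ).target := chart_one_mem_target
  have h5 : tangentDeriv E E ((φ ∘ (fun h ↦ h * g)) ∘ (φ).symm) ((φ) 1)
      = (tangentDeriv E E (φ) g).comp (tangentDeriv E E (fun h ↦ h * g) 1) := by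
    rw [tangentDeriv_comp (E' := E), tangentDeriv_chart_symm, h4, tangentDeriv_comp (E' := E),
      one_mul, ContinuousLinearMap.comp_id]
    · exact mdifferentiableAt_chart (by simpa using hg)
    · exact mdifferentiable_mul_right' g 1
    · rw [h4]
      exact (mdifferentiableAt_chart (by simpa using hg)).comp _ (mdifferentiable_mul_right' g 1)
    · exact mdifferentiableAt_chart_symm hg1
  rw [h3] at h2
  rw [tangentDeriv_eq_fderiv, h2.fderiv] at h5
  have h6 := tangentDeriv_mul_right (1 : G) g v
  rw [leftTranslate_one E G, one_mul] at h6
  rw [← h6]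
  simpa using congrArg (fun f : E →L[ℝ] E ↦ f v) h5

variable (G) in
/-- The left-invariant vector field extending `v`, in the chart at the identity. -/
def leftFieldChart (v : E) (q : E) : E := fderiv ℝ (mulChart E G) (q, (φ) 1) (0, v)

theorem leftFieldChart_apply {g : G} (hg : g ∈ (φ).source) (v : E) :
    leftFieldChart G v ((φ) g) = tangentDeriv E E (φ) g (leftTranslate g v) :=
  fderiv_mulChart_left hg v

omit [LieGroup 𝓘(ℝ, E) ∞ G] in
theorem contDiffAt_fderiv_mulChart {p : E × E} (hp : ContDiffAt ℝ ∞ (mulChart E G) p) :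
    ContDiffAt ℝ ∞ (fderiv ℝ (mulChart E G)) p :=
  hp.fderiv_right (by simp)

theorem contDiffOn_leftFieldChart (v : E) : ContDiffOn ℝ ∞ (leftFieldChart G v) (φ).target := by
  intro q hq
  refine ContDiffAt.contDiffWithinAt ?_
  have h1 := contDiffAt_mulChart_left (E := E) ((φ).map_target hq)
  rw [(φ).right_inv hq] at h1
  have h2 := ContDiffAt.comp q (contDiffAt_fderiv_mulChart h1)
    (contDiffAt_id.prodMk (contDiffAt_const (c := (φ) 1)))
  exact h2.clm_apply contDiffAt_const

theorem mlieBracket_leftTranslate_one (x y : E) :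
    mlieBracket 𝓘(ℝ, E) (fun g : G ↦ leftTranslate (E := E) g x)
        (fun g ↦ leftTranslate (E := E) g y) 1
      = lieBracket ℝ (leftFieldChart G x) (leftFieldChart G y) ((φ) 1) := by
  -- the left-invariant field of `v` in the chart, as it occurs in the definition of the bracket
  let F (v : E) (q : E) : E :=
    (mfderivWithin 𝓘(ℝ, E) 𝓘(ℝ, E) (φ).symm (Set.range 𝓘(ℝ, E)) q : E →L[ℝ] E).inverse
      (leftTranslate (E := E) ((φ).symm q) v)
  have hF : ∀ v, F v =ᶠ[𝓝 ((φ) 1)] leftFieldChart G v := fun v ↦ by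
    filter_upwards [(isOpen_extChartAt_target (I := 𝓘(ℝ, E)) (1 : G)).mem_nhds
      (mem_extChartAt_target (1 : G))] with q hq
    have h1 := leftFieldChart_apply (E := E) ((φ).map_target hq) v
    rw [(φ).right_inv hq] at h1
    rw [h1]
    have h2 := mfderiv_extChartAt_comp_mfderivWithin_extChartAt_symm (I := 𝓘(ℝ, E)) hq
    have h3 := mfderivWithin_extChartAt_symm_comp_mfderiv_extChartAt (I := 𝓘(ℝ, E)) hq
    exact congrArg (fun f : E →L[ℝ] E ↦ f _) (ContinuousLinearMap.inverse_eq h3 h2)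
  have h1 : mlieBracket 𝓘(ℝ, E) (fun g : G ↦ leftTranslate (E := E) g x)
      (fun g ↦ leftTranslate (E := E) g y) 1
    = (tangentDeriv E E (φ) 1).inverse
      (lieBracketWithin ℝ (F x) (F y) ((φ).symm ⁻¹' Set.univ ∩ Set.range 𝓘(ℝ, E)) ((φ) 1)) := rfl
  rw [h1, tangentDeriv_extChartAt_self, ContinuousLinearMap.inverse_id]
  have h2 : (φ).symm ⁻¹' Set.univ ∩ Set.range 𝓘(ℝ, E) = Set.univ := by simp
  rw [h2, lieBracketWithin_univ, (hF x).lieBracket_vectorField_eq (hF y)]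
  rfl

end MulChart

/-! ### One-parameter subgroups -/

section OneParameterSubgroups

variable {E : Type*} [NormedAddCommGroup E] [NormedSpace ℝ E]
  {G : Type*} [TopologicalSpace G] [ChartedSpace E G] [Group G] [LieGroup 𝓘(ℝ, E) ∞ G]

/-- The chart at the identity. -/
local notation "φ" => extChartAt 𝓘(ℝ, E) (1 : G)

variable (G) in
/-- The Lie bracket of the Lie algebra of `G`, identified with the model space: the value at the
identity of the bracket of left-invariant vector fields. -/
def groupBracket (x y : E) : E :=
  mlieBracket 𝓘(ℝ, E) (fun g : G ↦ leftTranslate (E := E) g x)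
    (fun g ↦ leftTranslate (E := E) g y) 1

theorem leftFieldChart_one (v : E) : leftFieldChart G v ((φ) 1) = v := by
  rw [leftFieldChart_apply (mem_extChartAt_source 1), tangentDeriv_extChartAt_self,
    leftTranslate_one]
  rfl

theorem hasDerivAt_ringInverse_of_eq_one {R : Type*} [NormedRing R] [NormedAlgebra ℝ R]
    [HasSummableGeomSeries R] {A : ℝ → R} {A' : R} {t : ℝ} (hA : HasDerivAt A A' t)
    (h1 : A t = 1) : HasDerivAt (fun s ↦ Ring.inverse (A s)) (-A') t := by
  have h := hasFDerivAt_ringInverse (𝕜 := ℝ) (1 : Rˣ)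
  rw [Units.val_one, ← h1] at h
  exact (h.comp_hasDerivAt t hA).congr_deriv (by
    rw [inv_one, neg_apply, ContinuousLinearMap.mulLeftRight_apply,
      Units.val_one, one_mul, mul_one])

/-- The derivative of the adjoint representation is the bracket. In the chart at the identity,
`Ad (γ s)⁻¹ y` solves `A s (Ad (γ s)⁻¹ y) = w s`, where `A s` and `w s` come from the first
derivatives of the multiplication `m`; both sides of the claim are then second derivatives of
`m`. -/
theorem hasDerivAt_adjointMap_inv_zero [CompleteSpace E] {γ : ℝ → G} {x : E}
    (hγ : HasVelocityAt γ x 0) (h0 : γ 0 = 1) (y : E) :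
    HasDerivAt (fun s ↦ adjointMap (γ s)⁻¹ y) (- groupBracket G x y) 0 := by
  set e : E := (φ) 1 with he
  set m := mulChart E G with hm
  have hcd : ContDiffAt ℝ ∞ m (e, e) := contDiffAt_mulChart_left (mem_extChartAt_source 1)
  set H := fderiv ℝ (fderiv ℝ m) (e, e) with hH
  have hHd : HasFDerivAt (fderiv ℝ m) H (e, e) :=
    ((contDiffAt_fderiv_mulChart hcd).differentiableAt (by simp)).hasFDerivAt
  have hsymm : ∀ v w, H v w = H w v := by
    have := hcd.isSymmSndFDerivAt (by
      rw [minSmoothness_of_isRCLikeNormedField]; exact ENat.LEInfty.out)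
    exact fun v w ↦ this v w
  -- the bracket in terms of the second derivative of the multiplication
  have hLF : ∀ v w, fderiv ℝ (leftFieldChart G v) e w = H (w, 0) (0, v) := by
    intro v w
    have h1 : HasFDerivAt (fun q : E ↦ fderiv ℝ m (q, e)) _ e :=
      HasFDerivAt.comp (f := fun q : E ↦ (q, e)) (g := fderiv ℝ m) e hHd
        ((hasFDerivAt_id e).prodMk (hasFDerivAt_const e e))
    have h2 := h1.clm_apply (hasFDerivAt_const ((0, v) : E × E) e)
    have h3 : leftFieldChart G v = fun q ↦ fderiv ℝ m (q, e) (0, v) := rfl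
    rw [h3, h2.fderiv]
    simp
  have hbr : groupBracket G x y = H (x, 0) (0, y) - H (y, 0) (0, x) := by
    unfold groupBracket
    rw [mlieBracket_leftTranslate_one, lieBracket, leftFieldChart_one, leftFieldChart_one, hLF, hLF]
  have hsrc : ∀ᶠ s in 𝓝 (0 : ℝ), γ s ∈ (φ).source := by
    have hc : ContinuousAt γ 0 := HasMFDerivAt.continuousAt hγ
    refine hc.preimage_mem_nhds ?_
    rw [h0]
    exact extChartAt_source_mem_nhds 1
  have hp : HasDerivAt (fun s ↦ (φ) (γ s)) x 0 := by
    have hd : MDifferentiableAt 𝓘(ℝ, E) 𝓘(ℝ, E) (φ) (γ 0) := by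
      rw [h0]; exact mdifferentiableAt_chart (mem_extChartAt_source 1)
    have h1 := HasVelocityAt.comp hd hγ
    rw [h0, tangentDeriv_extChartAt_self] at h1
    exact hasVelocityAt_iff_hasDerivAt.1 h1
  have hp0 : (φ : G → E) (γ 0) = e := by rw [h0]
  -- `A s` and `w s` are the derivatives of left and right translation by `γ s`
  let A : ℝ → (E →L[ℝ] E) := fun s ↦
    (fderiv ℝ m ((φ) (γ s), e)).comp (ContinuousLinearMap.inr ℝ E E)
  let w : ℝ → E := fun s ↦ fderiv ℝ m (e, (φ) (γ s)) (y, 0)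
  have hrel : ∀ᶠ s in 𝓝 (0 : ℝ), A s (adjointMap (γ s)⁻¹ y) = w s := by
    filter_upwards [hsrc] with s hs
    simp only [A, w, ContinuousLinearMap.comp_apply, ContinuousLinearMap.inr_apply]
    rw [fderiv_mulChart_left hs, fderiv_mulChart_right hs]
  have hA0 : A 0 = 1 := by
    ext v
    simp only [A, ContinuousLinearMap.comp_apply, ContinuousLinearMap.inr_apply, hp0]
    exact leftFieldChart_one v
  have hA : HasDerivAt A ((H (x, 0)).comp (ContinuousLinearMap.inr ℝ E E)) 0 := by
    have h1 : HasDerivAt (fun s ↦ ((φ) (γ s), e)) (x, (0 : E)) 0 :=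
      hp.prodMk (hasDerivAt_const 0 e)
    have h2 : HasDerivAt (fun s ↦ fderiv ℝ m ((φ) (γ s), e)) (H (x, 0)) 0 :=
      HasFDerivAt.comp_hasDerivAt (l := fderiv ℝ m) 0 (by simpa only [hp0] using hHd) h1
    exact (h2.clm_comp (hasDerivAt_const 0 (ContinuousLinearMap.inr ℝ E E))).congr_deriv (by simp)
  have hw : HasDerivAt w (H (0, x) (y, 0)) 0 := by
    have h1 : HasDerivAt (fun s ↦ (e, (φ) (γ s))) ((0 : E), x) 0 :=
      (hasDerivAt_const 0 e).prodMk hp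
    have h2 : HasDerivAt (fun s ↦ fderiv ℝ m (e, (φ) (γ s))) (H (0, x)) 0 :=
      HasFDerivAt.comp_hasDerivAt (l := fderiv ℝ m) 0 (by simpa only [hp0] using hHd) h1
    exact (h2.clm_apply (hasDerivAt_const 0 ((y, 0) : E × E))).congr_deriv (by simp)
  have hw0 : w 0 = y := by
    have := hrel.self_of_nhds
    rw [hA0, h0, inv_one, adjointMap_one] at this
    exact this.symm
  have hR : HasDerivAt (fun s ↦ Ring.inverse (A s))
      (-((H (x, 0)).comp (ContinuousLinearMap.inr ℝ E E))) 0 :=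
    hasDerivAt_ringInverse_of_eq_one hA hA0
  have hz := hR.clm_apply hw
  have hunit : ∀ᶠ s in 𝓝 (0 : ℝ), IsUnit (A s) := by
    refine hA.continuousAt.eventually_mem (s := {a | IsUnit a}) ?_
    rw [hA0]
    exact Units.nhds 1
  refine (hz.congr_of_eventuallyEq ?_).congr_deriv ?_
  · filter_upwards [hrel, hunit] with s hs hu
    rw [← hs]
    exact (congrArg (fun f : E →L[ℝ] E ↦ f (adjointMap (γ s)⁻¹ y))
      (Ring.inverse_mul_cancel _ hu)).symm
  · rw [hbr, hw0, hA0, Ring.inverse_one, hsymm (y, 0)]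
    simp [add_comm, sub_eq_add_neg]

theorem t2Space_of_lieGroup (E G : Type*) [NormedAddCommGroup E] [NormedSpace ℝ E]
    [TopologicalSpace G] [ChartedSpace E G] [Group G] [LieGroup 𝓘(ℝ, E) ∞ G] : T2Space G := by
  have : IsTopologicalGroup G := topologicalGroup_of_lieGroup 𝓘(ℝ, E) ∞
  have : T1Space G := 𝓘(ℝ, E).t1Space G
  infer_instance

theorem contMDiff_one_leftTranslate (v : E) :
    ContMDiff 𝓘(ℝ, E) 𝓘(ℝ, E).tangent 1
      (fun g : G ↦ (⟨g, leftTranslate (E := E) g v⟩ : TangentBundle 𝓘(ℝ, E) G)) :=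
  (contMDiff_leftTranslate v).of_le (by simp)

theorem eq_of_hasLeftDerivAt_const {c d : ℝ → G} {x : E} (hc : ∀ t, HasLeftDerivAt c x t)
    (hd : ∀ t, HasLeftDerivAt d x t) (h0 : c 0 = d 0) : c = d := by
  have := t2Space_of_lieGroup E G
  exact isMIntegralCurve_Ioo_eq_of_contMDiff_boundaryless (t₀ := 0) (I := 𝓘(ℝ, E))
    (contMDiff_one_leftTranslate x) hc hd h0

variable [CompleteSpace E]

/-- A local integral curve through the identity extends to all times, because its left translates
are integral curves defined on intervals of the same length. -/
theorem exists_oneParam (x : E) : ∃ γ : ℝ → G, γ 0 = 1 ∧ ∀ t, HasLeftDerivAt γ x t := by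
  have := t2Space_of_lieGroup E G
  obtain ⟨γ, hγ0, hγ⟩ := exists_isMIntegralCurveAt_of_contMDiffAt_boundaryless (t₀ := 0)
    (I := 𝓘(ℝ, E)) (contMDiff_one_leftTranslate (G := G) x (1 : G))
  have hγ' : ∀ᶠ t in 𝓝 (0 : ℝ), HasLeftDerivAt γ x t := hγ
  obtain ⟨ε, hε, hb⟩ := Metric.eventually_nhds_iff_ball.1 hγ'
  refine exists_isMIntegralCurve_of_isMIntegralCurveOn (I := 𝓘(ℝ, E))
    (contMDiff_one_leftTranslate x) hε (fun g ↦ ⟨fun t ↦ g * γ t, by simp [hγ0], ?_⟩) 1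
  intro t ht
  have ht' : t ∈ Metric.ball (0 : ℝ) ε := by rw [Real.ball_eq_Ioo]; simpa using ht
  exact HasMFDerivAt.hasMFDerivWithinAt ((hb t ht').mul_left g)

variable (G) in
/-- The one-parameter subgroup of `G` with velocity `x` at the identity. -/
def oneParam (x : E) : ℝ → G := (exists_oneParam x).choose

variable (G) in
theorem oneParam_zero (x : E) : oneParam G x 0 = 1 := (exists_oneParam x).choose_spec.1

variable (G) in
theorem hasLeftDerivAt_oneParam (x : E) (t : ℝ) : HasLeftDerivAt (oneParam G x) x t :=
  (exists_oneParam x).choose_spec.2 t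

theorem eq_oneParam {c : ℝ → G} {x : E} (hc : ∀ t, HasLeftDerivAt c x t) (h0 : c 0 = 1) (t : ℝ) :
    c t = oneParam G x t :=
  congrFun (eq_of_hasLeftDerivAt_const hc (hasLeftDerivAt_oneParam G x)
    (h0.trans (oneParam_zero G x).symm)) t

omit [LieGroup 𝓘(ℝ, E) ∞ G] [CompleteSpace E] in
theorem HasLeftDerivAt.scomp {c : ℝ → G} {ξ : E} {t : ℝ} {f : ℝ → ℝ} {f' : ℝ}
    (hc : HasLeftDerivAt c ξ (f t)) (hf : HasDerivAt f f' t) :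
    HasLeftDerivAt (fun s ↦ c (f s)) (f' • ξ) t := by
  have h := HasVelocityAt.scomp hc hf
  rw [← map_smul] at h
  exact h

variable (G) in
theorem oneParam_add (x : E) (s t : ℝ) :
    oneParam G x (s + t) = oneParam G x s * oneParam G x t := by
  refine congrFun (eq_of_hasLeftDerivAt_const (c := fun t ↦ oneParam G x (s + t)) (x := x)
    (fun t ↦ ?_) (fun t ↦ (hasLeftDerivAt_oneParam G x t).mul_left _) ?_) t
  · simpa using HasLeftDerivAt.scomp (hasLeftDerivAt_oneParam G x (s + t))
      ((hasDerivAt_id t).const_add s)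
  · simp [oneParam_zero]

variable (G) in
theorem oneParam_neg (x : E) (t : ℝ) : oneParam G x (-t) = (oneParam G x t)⁻¹ := by
  rw [eq_inv_iff_mul_eq_one, ← oneParam_add, neg_add_cancel, oneParam_zero]

variable (G) in
theorem oneParam_smul (x : E) (a t : ℝ) : oneParam G (a • x) t = oneParam G x (a * t) := by
  refine (eq_oneParam (c := fun t ↦ oneParam G x (a * t)) (x := a • x) (fun t ↦ ?_) ?_ t).symm
  · simpa using HasLeftDerivAt.scomp (hasLeftDerivAt_oneParam G x (a * t))
      ((hasDerivAt_id t).const_mul a)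
  · simp [oneParam_zero]

variable (G) in
theorem continuous_oneParam (x : E) : Continuous (oneParam G x) :=
  continuous_iff_continuousAt.2 fun t ↦ HasMFDerivAt.continuousAt (hasLeftDerivAt_oneParam G x t)

theorem contMDiff_oneParam (x : E) : ContMDiff 𝓘(ℝ, ℝ) 𝓘(ℝ, E) ∞ (oneParam G x) := by
  have h0 : ContMDiffAt 𝓘(ℝ, ℝ) 𝓘(ℝ, E) ∞ (oneParam G x) 0 := by
    set J := oneParam G x ⁻¹' (φ).source with hJ
    have hJo : IsOpen J := (isOpen_extChartAt_source 1).preimage (continuous_oneParam G x)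
    have h0J : (0 : ℝ) ∈ J := by simp [hJ, oneParam_zero]
    have h1 : ContDiffOn ℝ ∞ (fun t ↦ (φ) (oneParam G x t)) J := by
      refine contDiffOn_of_hasDerivAt_of_contDiffOn (contDiffOn_leftFieldChart (G := G) x) hJo
        (fun t ht ↦ (φ).map_source ht) fun t ht ↦ ?_
      rw [leftFieldChart_apply ht]
      exact hasVelocityAt_iff_hasDerivAt.1
        (HasVelocityAt.comp (mdifferentiableAt_chart ht) (hasLeftDerivAt_oneParam G x t))
    have h2 : ContMDiffAt 𝓘(ℝ, ℝ) 𝓘(ℝ, E) ∞ (fun t ↦ (φ).symm ((φ) (oneParam G x t))) 0 := by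
      refine ContMDiffAt.comp 0 (contMDiffAt_chart_symm ((φ).map_source h0J)) ?_
      exact (h1.contDiffAt (hJo.mem_nhds h0J)).contMDiffAt
    refine h2.congr_of_eventuallyEq ?_
    filter_upwards [hJo.mem_nhds h0J] with t ht
    exact ((φ).left_inv ht).symm
  intro t
  have h2 : oneParam G x = fun s ↦ oneParam G x t * oneParam G x (s - t) := by
    ext s
    rw [← oneParam_add]
    congr 1
    ring
  rw [h2]
  refine (contMDiff_mul_left (I := 𝓘(ℝ, E)) (n := ∞) (a := oneParam G x t)).contMDiffAt.comp t ?_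
  refine ContMDiffAt.comp t (by rwa [sub_self]) ?_
  exact (contDiff_id.sub contDiff_const).contMDiff.contMDiffAt

theorem hasVelocityAt_oneParam_zero (x : E) : HasVelocityAt (oneParam G x) x 0 := by
  have h := hasLeftDerivAt_oneParam G x 0
  unfold HasLeftDerivAt at h
  rw [oneParam_zero, leftTranslate_one] at h
  exact h

theorem conj_oneParam (g : G) (x : E) (t : ℝ) :
    g * oneParam G x t * g⁻¹ = oneParam G (adjointMap g x) t :=
  eq_oneParam (fun t ↦ (hasLeftDerivAt_oneParam G x t).conj g) (by simp [oneParam_zero]) t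

theorem hasDerivAt_adjointMap_oneParam_zero (x y : E) :
    HasDerivAt (fun s ↦ adjointMap (oneParam G x s) y) (groupBracket G x y) 0 := by
  have h := hasDerivAt_adjointMap_inv_zero (hasVelocityAt_oneParam_zero (G := G) x)
    (oneParam_zero G x) y
  have h2 := HasDerivAt.scomp (0 : ℝ) (h := fun s : ℝ ↦ -s) (by simpa using h)
    (hasDerivAt_neg (0 : ℝ))
  simpa [Function.comp_def, oneParam_neg] using h2

variable (G) in
theorem hasDerivAt_adjointMap_oneParam (x y : E) (t : ℝ) :
    HasDerivAt (fun s ↦ adjointMap (oneParam G x s) y)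
      (groupBracket G x (adjointMap (oneParam G x t) y)) t := by
  have h := hasDerivAt_adjointMap_oneParam_zero (G := G) x (adjointMap (oneParam G x t) y)
  have h2 := HasDerivAt.scomp t (h := fun s : ℝ ↦ s - t) (by simpa using h)
    ((hasDerivAt_id t).sub_const t)
  simpa [Function.comp_def, ← adjointMap_mul, ← oneParam_add] using h2

variable (G) in
theorem hasDerivAt_adjointMap_oneParam' (x y : E) (t : ℝ) :
    HasDerivAt (fun s ↦ adjointMap (oneParam G x s) y)
      (adjointMap (oneParam G x t) (groupBracket G x y)) t := by
  have h := hasDerivAt_adjointMap_oneParam_zero (G := G) x y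
  have h2 := HasDerivAt.scomp t (h := fun s : ℝ ↦ s - t) (by simpa using h)
    ((hasDerivAt_id t).sub_const t)
  have h3 := ((adjointMap (E := E) (oneParam G x t)).hasFDerivAt).comp_hasDerivAt t h2
  simpa [Function.comp_def, ← adjointMap_mul, ← oneParam_add] using h3

theorem adjointMap_oneParam_of_bracket_eq_zero {x y : E} (h : groupBracket G x y = 0) (t : ℝ) :
    adjointMap (oneParam G x t) y = y := by
  have h1 : ∀ t, HasDerivAt (fun s ↦ adjointMap (oneParam G x s) y) 0 t := fun t ↦ by
    simpa [h] using hasDerivAt_adjointMap_oneParam' G x y t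
  have h2 := is_const_of_deriv_eq_zero (fun t ↦ (h1 t).differentiableAt) (fun t ↦ (h1 t).deriv) t 0
  simpa [oneParam_zero, adjointMap_one] using h2

theorem oneParam_mul_comm {x y : E} (h : groupBracket G x y = 0) (s t : ℝ) :
    oneParam G x s * oneParam G y t = oneParam G y t * oneParam G x s := by
  have := conj_oneParam (oneParam G x s) y t
  rw [adjointMap_oneParam_of_bracket_eq_zero h] at this
  exact mul_inv_eq_iff_eq_mul.1 this

theorem oneParam_add_vec {x y : E} (hxy : groupBracket G y x = 0) (t : ℝ) :
    oneParam G (x + y) t = oneParam G x t * oneParam G y t := by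
  refine (eq_oneParam (c := fun t ↦ oneParam G x t * oneParam G y t) (fun t ↦ ?_)
    (by simp [oneParam_zero]) t).symm
  have h := (hasLeftDerivAt_oneParam G x t).mul (hasLeftDerivAt_oneParam G y t)
  rwa [← oneParam_neg, adjointMap_oneParam_of_bracket_eq_zero hxy] at h

end OneParameterSubgroups

/-! ### Generation by one-parameter subgroups -/

section Generation

variable {E : Type*} [NormedAddCommGroup E] [NormedSpace ℝ E] [CompleteSpace E]
  {G : Type*} [TopologicalSpace G] [ChartedSpace E G] [Group G] [LieGroup 𝓘(ℝ, E) ∞ G]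

variable (G) in
/-- Coordinates of the second kind: the product of the `exp (t i • x i)`, in increasing order
of `i`. -/
def expProd {n : ℕ} (x : Fin n → E) (t : Fin n → ℝ) : G :=
  (List.ofFn fun i ↦ oneParam G (x i) (t i)).prod

theorem expProd_succ {n : ℕ} (x : Fin (n + 1) → E) (t : Fin (n + 1) → ℝ) :
    expProd G x t = oneParam G (x 0) (t 0) * expProd G (fun i ↦ x i.succ) (fun i ↦ t i.succ) := by
  simp [expProd, List.ofFn_succ]

theorem expProd_append {m n : ℕ} (x : Fin m → E) (y : Fin n → E) (t : Fin (m + n) → ℝ) :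
    expProd G (Fin.append x y) t = expProd G x (fun i ↦ t (Fin.castAdd n i))
      * expProd G y (fun i ↦ t (Fin.natAdd m i)) := by
  unfold expProd
  rw [← List.prod_append, ← List.ofFn_fin_append]
  congr 2
  ext i
  refine Fin.addCases (fun i ↦ ?_) (fun i ↦ ?_) i <;> simp

theorem contMDiff_expProd {n : ℕ} (x : Fin n → E) :
    ContMDiff 𝓘(ℝ, Fin n → ℝ) 𝓘(ℝ, E) ∞ (expProd G x) := by
  induction n with
  | zero =>
    have : expProd G x = fun _ ↦ 1 := by ext; simp [expProd]
    rw [this]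
    exact contMDiff_const
  | succ n ih =>
    have : expProd G x = fun t ↦ oneParam G (x 0) (t 0)
        * expProd G (fun i ↦ x i.succ) (fun i ↦ t i.succ) := funext (expProd_succ x)
    rw [this]
    refine ContMDiff.mul ((contMDiff_oneParam (x 0)).comp (contDiff_apply ℝ ℝ 0).contMDiff) ?_
    have hpi : ContDiff ℝ ∞ (fun (t : Fin (n + 1) → ℝ) (i : Fin n) ↦ t i.succ) :=
      contDiff_pi.2 fun i ↦ contDiff_apply ℝ ℝ i.succ
    exact (ih _).comp hpi.contMDiff

theorem expProd_zero {n : ℕ} (x : Fin n → E) : expProd G x 0 = 1 := by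
  simp [expProd, oneParam_zero]

theorem oneParam_zero_vec (t : ℝ) : oneParam G (0 : E) t = 1 := by
  simpa [oneParam_zero] using oneParam_smul G (0 : E) 0 t

theorem hasLeftDerivAt_expProd {n : ℕ} (x : Fin n → E) (a : Fin n → ℝ) :
    HasLeftDerivAt (fun s : ℝ ↦ expProd G x (s • a)) (∑ i, a i • x i) 0 := by
  induction n with
  | zero =>
    have : (fun s : ℝ ↦ expProd G x (s • a)) = fun _ ↦ 1 := by ext; simp [expProd]
    rw [this]
    have h := (hasLeftDerivAt_oneParam G (0 : E) 0)
    have h2 : oneParam G (0 : E) = fun _ ↦ 1 := funext oneParam_zero_vec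
    rw [h2] at h
    simpa using h
  | succ n ih =>
    have h1 := (HasLeftDerivAt.scomp (f := fun s : ℝ ↦ s * a 0) (t := 0)
      (hasLeftDerivAt_oneParam G (x 0) _) (hasDerivAt_mul_const (a 0))).mul
      (ih (fun i ↦ x i.succ) (fun i ↦ a i.succ))
    have h2 : expProd G (fun i ↦ x i.succ) ((0 : ℝ) • fun i ↦ a i.succ) = 1 := by
      rw [zero_smul, expProd_zero]
    rw [h2, inv_one, adjointMap_one, ← Fin.sum_univ_succ (f := fun i ↦ a i • x i)] at h1
    have h3 : (fun s : ℝ ↦ expProd G x (s • a)) = fun s ↦ oneParam G (x 0) (s * a 0)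
        * expProd G (fun i ↦ x i.succ) (s • fun i ↦ a i.succ) := by
      ext s
      rw [expProd_succ]
      rfl
    rw [h3]
    exact h1

/-- The derivative of `expProd` at zero is `a ↦ ∑ a i • x i`, which is onto if the `x i` span; so
`expProd` is open at zero. -/
theorem image_expProd_mem_nhds {n : ℕ} {x : Fin n → E} (hx : Submodule.span ℝ (Set.range x) = ⊤)
    {U : Set (Fin n → ℝ)} (hU : U ∈ 𝓝 0) : expProd G x '' U ∈ 𝓝 (1 : G) := by
  set φ := extChartAt 𝓘(ℝ, E) (1 : G) with hφ
  have hcont : ContinuousAt (expProd G x) 0 := (contMDiff_expProd x).continuous.continuousAt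
  have h1 : expProd G x 0 = 1 := expProd_zero x
  have hφd : ContMDiffAt 𝓘(ℝ, E) 𝓘(ℝ, E) ∞ φ (expProd G x 0) := by
    rw [h1]; exact contMDiffAt_chart (mem_extChartAt_source 1)
  have hcd : ContDiffAt ℝ ∞ (φ ∘ expProd G x) 0 :=
    (ContMDiffAt.comp 0 hφd (contMDiff_expProd x).contMDiffAt).contDiffAt
  have hstrict : HasStrictFDerivAt (φ ∘ expProd G x) (fderiv ℝ (φ ∘ expProd G x) 0) 0 :=
    hcd.hasStrictFDerivAt (by simp)
  have hderiv : ∀ a, fderiv ℝ (φ ∘ expProd G x) 0 a = ∑ i, a i • x i := by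
    intro a
    have h2 : HasDerivAt (fun s : ℝ ↦ (φ ∘ expProd G x) (s • a))
        (fderiv ℝ (φ ∘ expProd G x) 0 a) 0 := by
      have h3 : HasDerivAt (fun s : ℝ ↦ s • a) a 0 := by
        simpa using (hasDerivAt_id (0 : ℝ)).smul_const a
      refine HasFDerivAt.comp_hasDerivAt (l := φ ∘ expProd G x) (0 : ℝ) ?_ h3
      rw [zero_smul]
      exact hstrict.hasFDerivAt
    have h4 : HasVelocityAt (fun s : ℝ ↦ expProd G x (s • a))
      (leftTranslate (expProd G x ((0 : ℝ) • a)) (∑ i, a i • x i)) 0 := hasLeftDerivAt_expProd x a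
    have h5 : expProd G x ((0 : ℝ) • a) = 1 := by rw [zero_smul, expProd_zero]
    have hd : MDifferentiableAt 𝓘(ℝ, E) 𝓘(ℝ, E) φ (expProd G x ((0 : ℝ) • a)) := by
      rw [h5]; exact mdifferentiableAt_chart (mem_extChartAt_source 1)
    have h6 := HasVelocityAt.comp hd h4
    rw [h5, leftTranslate_one, hφ, tangentDeriv_extChartAt_self] at h6
    exact h2.unique (hasVelocityAt_iff_hasDerivAt.1 h6)
  have hsurj : (fderiv ℝ (φ ∘ expProd G x) 0).range = ⊤ := by
    rw [eq_top_iff, ← hx, Submodule.span_le]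
    rintro _ ⟨i, rfl⟩
    refine ⟨Pi.single i 1, ?_⟩
    have := hderiv (Pi.single i 1)
    simpa [Pi.single_apply] using this
  have hmap := hstrict.map_nhds_eq_of_surj hsurj
  have hU' : U ∩ expProd G x ⁻¹' φ.source ∈ 𝓝 (0 : Fin n → ℝ) :=
    inter_mem hU (hcont.preimage_mem_nhds (by rw [h1]; exact extChartAt_source_mem_nhds 1))
  have h7 : (φ ∘ expProd G x) '' (U ∩ expProd G x ⁻¹' φ.source) ∈ 𝓝 (φ 1) := by
    have := image_mem_map (m := φ ∘ expProd G x) hU'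
    rw [hmap] at this
    simpa only [Function.comp_apply, h1] using this
  have h8 := (continuousAt_extChartAt (I := 𝓘(ℝ, E)) (1 : G)).preimage_mem_nhds h7
  filter_upwards [h8, extChartAt_source_mem_nhds (I := 𝓘(ℝ, E)) (1 : G)] with g hg hgs
  obtain ⟨t, ⟨htU, hts⟩, ht⟩ := hg
  exact ⟨t, htU, φ.injOn hts hgs ht⟩

theorem eq_top_of_oneParam_mem [ConnectedSpace G] {n : ℕ} {x : Fin n → E}
    (hx : Submodule.span ℝ (Set.range x) = ⊤) (S : Subgroup G)
    (hS : ∀ i t, oneParam G (x i) t ∈ S) : S = ⊤ := by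
  have : IsTopologicalGroup G := topologicalGroup_of_lieGroup 𝓘(ℝ, E) ∞
  have h1 : (S : Set G) ∈ 𝓝 1 := by
    refine mem_of_superset (image_expProd_mem_nhds hx univ_mem) ?_
    rintro _ ⟨t, -, rfl⟩
    refine S.list_prod_mem fun g hg ↦ ?_
    obtain ⟨i, rfl⟩ := List.mem_ofFn.1 hg
    exact hS i _
  have h2 := S.isOpen_of_mem_nhds h1
  have h3 : IsClopen (S : Set G) := ⟨S.isClosed_of_isOpen h2, h2⟩
  exact SetLike.coe_injective (h3.eq_univ ⟨1, S.one_mem⟩)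

theorem expProd_eq_oneParam {n : ℕ} {x : Fin n → E} {U : Submodule ℝ E}
    (hU : ∀ x ∈ U, ∀ y ∈ U, groupBracket G x y = 0) (hx : ∀ i, x i ∈ U) (t : Fin n → ℝ) :
    expProd G x t = oneParam G (∑ i, t i • x i) 1 := by
  induction n with
  | zero => simp [expProd, oneParam_zero_vec]
  | succ n ih =>
    rw [expProd_succ, ih (fun i ↦ hx i.succ), Fin.sum_univ_succ, oneParam_add_vec, oneParam_smul,
      mul_one]
    exact hU _ (U.sum_mem fun i _ ↦ U.smul_mem _ (hx i.succ)) _ (U.smul_mem _ (hx 0))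

end Generation

/-! ### The modular character -/

section Haar

open MeasureTheory Measure

/-- If conjugation by `g` preserves a compact neighbourhood `K` of the identity, then right
translation by `g` preserves the left Haar measure of `K`, which is neither zero nor infinite. -/
theorem modularCharacter_eq_one_of_conj {G : Type*} [TopologicalSpace G] [Group G]
    [IsTopologicalGroup G] [LocallyCompactSpace G] [T2Space G] {K : Set G} (hK : IsCompact K)
    (hK1 : K ∈ 𝓝 1) {g : G} (hg : ∀ k, g * k * g⁻¹ ∈ K ↔ k ∈ K) : modularCharacter g = 1 := by
  let _ : MeasurableSpace G := borel G
  have : BorelSpace G := ⟨rfl⟩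
  let ν : Measure G := MeasureTheory.Measure.haar
  have h1 : modularCharacter g = haarScalarFactor (map (· * g) ν) ν :=
    modularCharacterFun_eq_haarScalarFactor ν g
  have h2 := measure_isMulInvariant_eq_smul_of_isCompact_closure (map (· * g) ν) ν
    (s := K) hK.closure
  have h3 : map (· * g) ν K = ν K := by
    rw [map_apply (measurable_mul_const g) hK.measurableSet, ← measure_preimage_mul ν g K]
    congr 1
    ext k
    have := hg (k * g)
    simpa [mul_assoc] using this.symm
  rw [h3, ← h1] at h2
  have h4 : ν K ≠ 0 := (measure_pos_of_mem_nhds ν hK1).ne'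
  have h5 : ν K ≠ ⊤ := hK.measure_lt_top.ne
  have h6 : ((modularCharacter g : NNReal) : ENNReal) = 1 := by
    have h7 : ((modularCharacter g : NNReal) : ENNReal) * ν K = 1 * ν K := by
      rw [one_mul]; exact h2.symm
    exact (ENNReal.mul_left_inj h4 h5).1 h7
  exact_mod_cast h6

end Haar

/-! ### Lie groups with an abelian ideal and an abelian complement acting by isometries -/

section Splitting

variable {E : Type*} [NormedAddCommGroup E] [NormedSpace ℝ E]
  {G : Type*} [TopologicalSpace G] [ChartedSpace E G] [Group G] [LieGroup 𝓘(ℝ, E) ∞ G]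

variable (G) in
/-- The structure of the Lie algebra of a flat Lie group with a left-invariant Riemannian metric
`h`: it is the orthogonal sum of an abelian subalgebra `u` and an abelian subalgebra `b` whose
adjoint action is skew for `h`. That `u` is an ideal follows. -/
structure IsFlatSplitting (h : E →L[ℝ] E →L[ℝ] ℝ) (u b : Submodule ℝ E) : Prop where
  symm : ∀ x y, h x y = h y x
  pos : ∀ x, x ≠ 0 → 0 < h x x
  bracket_left : ∀ x ∈ u, ∀ y ∈ u, groupBracket G x y = 0
  bracket_right : ∀ x ∈ b, ∀ y ∈ b, groupBracket G x y = 0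
  skew : ∀ x ∈ b, ∀ y z, h (groupBracket G x y) z = - h y (groupBracket G x z)
  ortho : ∀ x ∈ u, ∀ y ∈ b, h x y = 0
  sup_eq_top : u ⊔ b = ⊤

open MeasureTheory.Measure (modularCharacter)

namespace IsFlatSplitting

variable {h : E →L[ℝ] E →L[ℝ] ℝ} {u b : Submodule ℝ E} (hs : IsFlatSplitting G h u b)
include hs

omit [LieGroup 𝓘(ℝ, E) ∞ G] in
theorem eq_zero {x : E} (hx : h x x = 0) : x = 0 := by
  by_contra h0
  exact (hs.pos x h0).ne' hx

omit [LieGroup 𝓘(ℝ, E) ∞ G] in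
theorem mem_left_of_ortho {x : E} (hx : ∀ y ∈ b, h x y = 0) : x ∈ u := by
  obtain ⟨p, hp, q, hq, rfl⟩ := Submodule.mem_sup.1 (hs.sup_eq_top ▸ Submodule.mem_top : x ∈ u ⊔ b)
  have h1 := hx q hq
  rw [map_add, add_apply, hs.ortho p hp q hq, zero_add] at h1
  rw [hs.eq_zero h1, add_zero]
  exact hp

variable [CompleteSpace E]

theorem adjointMap_isometry {x : E} (hx : x ∈ b) (t : ℝ) (y z : E) :
    h (adjointMap (oneParam G x t) y) (adjointMap (oneParam G x t) z) = h y z := by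
  have h1 : ∀ t, HasDerivAt (fun s ↦ h (adjointMap (oneParam G x s) y)
      (adjointMap (oneParam G x s) z)) 0 t := fun t ↦ by
    have d1 := h.hasFDerivAt.comp_hasDerivAt t (hasDerivAt_adjointMap_oneParam G x y t)
    have d2 := d1.clm_apply (hasDerivAt_adjointMap_oneParam G x z t)
    refine d2.congr_deriv ?_
    rw [hs.skew x hx, Function.comp_apply, neg_add_cancel]
  have h2 := is_const_of_deriv_eq_zero (fun t ↦ (h1 t).differentiableAt) (fun t ↦ (h1 t).deriv) t 0
  simpa [oneParam_zero, adjointMap_one] using h2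

theorem adjointMap_right {x y : E} (hx : x ∈ b) (hy : y ∈ b) (t : ℝ) :
    adjointMap (oneParam G x t) y = y :=
  adjointMap_oneParam_of_bracket_eq_zero (hs.bracket_right x hx y hy) t

theorem adjointMap_left {x y : E} (hx : x ∈ u) (hy : y ∈ u) (t : ℝ) :
    adjointMap (oneParam G x t) y = y :=
  adjointMap_oneParam_of_bracket_eq_zero (hs.bracket_left x hx y hy) t

theorem adjointMap_mem {x y : E} (hx : x ∈ b) (hy : y ∈ u) (t : ℝ) :
    adjointMap (oneParam G x t) y ∈ u := by
  refine hs.mem_left_of_ortho fun z hz ↦ ?_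
  rw [← hs.adjointMap_right hx hz t, hs.adjointMap_isometry hx, hs.ortho y hy z hz]

omit [LieGroup 𝓘(ℝ, E) ∞ G] [CompleteSpace E] in
/-- An orthonormal basis `x` of `u` and a basis `y` of `b`, which together span `E`. -/
theorem exists_adapted [FiniteDimensional ℝ E] : ∃ (m n : ℕ) (x : Fin m → E) (y : Fin n → E),
    (∀ i, x i ∈ u) ∧ (∀ i, y i ∈ b) ∧ (∀ i j, h (x i) (x j) = if i = j then 1 else 0) ∧
    Submodule.span ℝ (Set.range x) = u ∧
    Submodule.span ℝ (Set.range (Fin.append x y)) = ⊤ := by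
  let K : E →ₗ[ℝ] E →ₗ[ℝ] ℝ := LinearMap.mk₂ ℝ (fun x y ↦ h x y) (by simp) (by simp) (by simp)
    (by simp)
  obtain ⟨m, f, hf⟩ := exists_orthonormal_basis_of_posDef (K.domRestrict₁₂ u u)
    (fun x y ↦ hs.symm x y) (fun x hx ↦ hs.pos x (by simpa using hx))
  let f' := Module.finBasis ℝ b
  have h1 : Submodule.span ℝ (Set.range fun i ↦ (f i : E)) = u := by
    have := congrArg (Submodule.map u.subtype) f.span_eq
    rw [Submodule.map_span, ← Set.range_comp] at this
    simpa [Function.comp_def] using this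
  have h2 : Submodule.span ℝ (Set.range fun i ↦ (f' i : E)) = b := by
    have := congrArg (Submodule.map b.subtype) f'.span_eq
    rw [Submodule.map_span, ← Set.range_comp] at this
    simpa [Function.comp_def] using this
  refine ⟨m, _, fun i ↦ f i, fun i ↦ f' i, fun i ↦ (f i).2, fun i ↦ (f' i).2,
    fun i j ↦ hf i j, h1, ?_⟩
  rw [eq_top_iff, ← hs.sup_eq_top]
  refine sup_le (h1.symm.trans_le (Submodule.span_mono ?_))
    (h2.symm.trans_le (Submodule.span_mono ?_))
  · rintro _ ⟨i, rfl⟩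
    exact ⟨Fin.castAdd _ i, Fin.append_left _ _ i⟩
  · rintro _ ⟨i, rfl⟩
    exact ⟨Fin.natAdd _ i, Fin.append_right _ _ i⟩

/-- A connected group is generated by `exp u` and `exp b`. -/
theorem eq_top_of_mem [FiniteDimensional ℝ E] [ConnectedSpace G] (S : Subgroup G)
    (h1 : ∀ x ∈ u, oneParam G x 1 ∈ S) (h2 : ∀ x ∈ b, oneParam G x 1 ∈ S) : S = ⊤ := by
  obtain ⟨m, n, x, y, hx, hy, -, -, hsp⟩ := hs.exists_adapted
  refine eq_top_of_oneParam_mem hsp S fun i t ↦ ?_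
  have h3 : oneParam G (Fin.append x y i) t = oneParam G (t • Fin.append x y i) 1 := by
    rw [oneParam_smul, mul_one]
  rw [h3]
  refine Fin.addCases (fun i ↦ ?_) (fun i ↦ ?_) i
  · rw [Fin.append_left]; exact h1 _ (u.smul_mem _ (hx i))
  · rw [Fin.append_right]; exact h2 _ (b.smul_mem _ (hy i))

/-- The subgroup `exp u`. -/
def leftSubgroup : Subgroup G where
  carrier := {g | ∃ x ∈ u, oneParam G x 1 = g}
  mul_mem' := by
    rintro _ _ ⟨x, hx, rfl⟩ ⟨y, hy, rfl⟩
    exact ⟨x + y, u.add_mem hx hy, oneParam_add_vec (hs.bracket_left y hy x hx) 1⟩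
  one_mem' := ⟨0, u.zero_mem, oneParam_zero_vec 1⟩
  inv_mem' := by
    rintro _ ⟨x, hx, rfl⟩
    refine ⟨-x, u.neg_mem hx, ?_⟩
    have := oneParam_smul G x (-1) 1
    rw [← oneParam_neg]
    simpa using this

theorem leftSubgroup_normal [FiniteDimensional ℝ E] [ConnectedSpace G] :
    (hs.leftSubgroup).Normal := by
  rw [← Subgroup.normalizer_eq_top_iff]
  have key : ∀ x : E, (∀ t, ∀ y ∈ u, adjointMap (oneParam G x t) y ∈ u) →
      oneParam G x 1 ∈ Subgroup.normalizer (hs.leftSubgroup : Set G) := by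
    intro x hx
    rw [Subgroup.mem_normalizer_iff]
    intro g
    constructor
    · rintro ⟨y, hy, rfl⟩
      rw [conj_oneParam]
      exact ⟨_, hx 1 y hy, rfl⟩
    · rintro ⟨y, hy, hg⟩
      refine ⟨_, hx (-1) y hy, ?_⟩
      rw [← conj_oneParam, hg, oneParam_neg]
      group
  refine hs.eq_top_of_mem _ (fun x hx ↦ key x fun t y hy ↦ ?_)
    fun x hx ↦ key x fun t y hy ↦ hs.adjointMap_mem hx hy t
  rw [hs.adjointMap_left hx hy]
  exact hy

theorem derivedSeries_two_eq_bot [FiniteDimensional ℝ E] [ConnectedSpace G] :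
    derivedSeries G 2 = ⊥ := by
  have hn := hs.leftSubgroup_normal
  set N := hs.leftSubgroup with hN
  have hmem : ∀ x ∈ u, QuotientGroup.mk' N (oneParam G x 1) = 1 := fun x hx ↦
    (QuotientGroup.eq_one_iff _).2 ⟨x, hx, rfl⟩
  -- the image of `exp b` is central modulo `exp u`
  have hcent : ∀ x ∈ b, QuotientGroup.mk' N (oneParam G x 1) ∈ Subgroup.center (G ⧸ N) := by
    intro x hx
    have h1 : (Subgroup.centralizer {QuotientGroup.mk' N (oneParam G x 1)}).comap
        (QuotientGroup.mk' N) = ⊤ := by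
      refine hs.eq_top_of_mem _ (fun y hy ↦ ?_) fun y hy ↦ ?_
      · rw [Subgroup.mem_comap, hmem y hy]
        exact Subgroup.one_mem _
      · rw [Subgroup.mem_comap, Subgroup.mem_centralizer_singleton_iff, ← map_mul, ← map_mul,
          oneParam_mul_comm (hs.bracket_right x hx y hy)]
    rw [Subgroup.mem_center_iff]
    intro q
    obtain ⟨g, rfl⟩ := QuotientGroup.mk'_surjective N q
    have h2 : g ∈ (Subgroup.centralizer {QuotientGroup.mk' N (oneParam G x 1)}).comap
        (QuotientGroup.mk' N) := h1 ▸ Subgroup.mem_top g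
    rw [Subgroup.mem_comap, Subgroup.mem_centralizer_singleton_iff] at h2
    exact h2
  have hall : (Subgroup.center (G ⧸ N)).comap (QuotientGroup.mk' N) = ⊤ := by
    refine hs.eq_top_of_mem _ (fun y hy ↦ ?_) fun y hy ↦ hcent y hy
    rw [Subgroup.mem_comap, hmem y hy]
    exact Subgroup.one_mem _
  have hcomm : ⁅(⊤ : Subgroup G), ⊤⁆ ≤ N := by
    rw [Subgroup.commutator_le]
    intro g _ k _
    have hg : g ∈ (Subgroup.center (G ⧸ N)).comap (QuotientGroup.mk' N) := hall ▸ Subgroup.mem_top g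
    rw [Subgroup.mem_comap, Subgroup.mem_center_iff] at hg
    rw [← QuotientGroup.eq_one_iff, ← QuotientGroup.mk'_apply, map_commutatorElement,
      commutatorElement_eq_one_iff_mul_comm]
    exact (hg _).symm
  rw [derivedSeries_succ, derivedSeries_one, eq_bot_iff]
  refine (Subgroup.commutator_mono hcomm hcomm).trans ?_
  rw [Subgroup.commutator_le]
  rintro _ ⟨x, hx, rfl⟩ _ ⟨y, hy, rfl⟩
  rw [Subgroup.mem_bot, commutatorElement_eq_one_iff_mul_comm]
  exact oneParam_mul_comm (hs.bracket_left x hx y hy) 1 1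

/-- Conjugation by `exp z` preserves the compact neighbourhood `K₁ * K₂` of the identity, where `K₁`
is the exponential of the unit ball of `u` and `K₂` the exponential of a box in `b`. -/
theorem modularCharacter_right [FiniteDimensional ℝ E] [IsTopologicalGroup G]
    [LocallyCompactSpace G] {z : E} (hz : z ∈ b) : modularCharacter (oneParam G z 1) = 1 := by
  have := t2Space_of_lieGroup E G
  obtain ⟨m, n, x, y, hx, hy, hxo, hxs, hsp⟩ := hs.exists_adapted
  have hsum : ∀ s : Fin m → ℝ, h (∑ i, s i • x i) (∑ i, s i • x i) = ∑ i, s i ^ 2 := by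
    intro s
    simp only [map_sum, map_smul, sum_apply, smul_apply, hxo]
    simp [pow_two]
  let C : Set (Fin m → ℝ) := {s | ∑ i, s i ^ 2 ≤ 1}
  have hC : IsCompact C := by
    refine Metric.isCompact_of_isClosed_isBounded ?_ ?_
    · exact isClosed_le (by fun_prop) continuous_const
    · refine (Metric.isBounded_closedBall (x := (0 : Fin m → ℝ)) (r := 1)).subset fun s hs' ↦ ?_
      rw [mem_closedBall_zero_iff, pi_norm_le_iff_of_nonneg zero_le_one]
      intro i
      have h1 : s i ^ 2 ≤ 1 :=
        (Finset.single_le_sum (f := fun i ↦ s i ^ 2) (fun i _ ↦ sq_nonneg _)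
          (Finset.mem_univ i)).trans hs'
      rw [Real.norm_eq_abs]
      exact (sq_le_one_iff_abs_le_one _).1 h1
  let K₁ : Set G := expProd G x '' C
  let K₂ : Set G := expProd G y '' Metric.closedBall 0 1
  have hK₁ : IsCompact K₁ := hC.image (contMDiff_expProd x).continuous
  have hK₂ : IsCompact K₂ :=
    (isCompact_closedBall _ _).image (contMDiff_expProd y).continuous
  have hK : IsCompact (K₁ * K₂) := hK₁.mul hK₂
  have hK₁eq : ∀ g, g ∈ K₁ ↔ ∃ v ∈ u, h v v ≤ 1 ∧ oneParam G v 1 = g := by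
    intro g
    constructor
    · rintro ⟨s, hs', rfl⟩
      refine ⟨∑ i, s i • x i, u.sum_mem fun i _ ↦ u.smul_mem _ (hx i), ?_, ?_⟩
      · rw [hsum]; exact hs'
      · exact (expProd_eq_oneParam hs.bracket_left hx s).symm
    · rintro ⟨v, hv, hv1, rfl⟩
      rw [← hxs, Submodule.mem_span_range_iff_exists_fun] at hv
      obtain ⟨s, rfl⟩ := hv
      refine ⟨s, ?_, expProd_eq_oneParam hs.bracket_left hx s⟩
      rw [hsum] at hv1
      exact hv1
  have hmem : K₁ * K₂ ∈ 𝓝 (1 : G) := by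
    have hU : {t : Fin (m + n) → ℝ | ∑ i, t (Fin.castAdd n i) ^ 2 < 1} ∩
        {t | ‖fun i ↦ t (Fin.natAdd m i)‖ < 1} ∈ 𝓝 (0 : Fin (m + n) → ℝ) := by
      refine inter_mem ?_ ?_
      · exact (isOpen_lt (by fun_prop) continuous_const).mem_nhds (by simp)
      · refine (isOpen_lt ?_ continuous_const).mem_nhds ?_
        · exact continuous_norm.comp (continuous_pi fun i ↦ continuous_apply _)
        · have : (fun i : Fin n ↦ (0 : Fin (m + n) → ℝ) (Fin.natAdd m i)) = 0 := rfl
          show ‖fun i : Fin n ↦ (0 : Fin (m + n) → ℝ) (Fin.natAdd m i)‖ < 1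
          rw [this, norm_zero]
          exact one_pos
    refine mem_of_superset (image_expProd_mem_nhds hsp hU) ?_
    rintro _ ⟨t, ⟨ht1, ht2⟩, rfl⟩
    rw [expProd_append]
    have ht3 : ∑ i, t (Fin.castAdd n i) ^ 2 ≤ 1 := le_of_lt ht1
    exact Set.mul_mem_mul ⟨_, ht3, rfl⟩ ⟨_, by simpa using le_of_lt ht2, rfl⟩
  have hconj : ∀ t : ℝ, ∀ k ∈ K₁ * K₂, oneParam G z t * k * (oneParam G z t)⁻¹ ∈ K₁ * K₂ := by
    rintro t _ ⟨k₁, hk₁, k₂, ⟨s, hs', rfl⟩, rfl⟩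
    rw [hK₁eq] at hk₁
    obtain ⟨v, hv, hv1, rfl⟩ := hk₁
    refine ⟨oneParam G z t * oneParam G v 1 * (oneParam G z t)⁻¹, ?_, expProd G y s,
      ⟨s, hs', rfl⟩, ?_⟩
    · rw [conj_oneParam, hK₁eq]
      exact ⟨_, hs.adjointMap_mem hz hv t, by rwa [hs.adjointMap_isometry hz], rfl⟩
    · have h1 : oneParam G z t * expProd G y s = expProd G y s * oneParam G z t := by
        rw [expProd_eq_oneParam hs.bracket_right hy]
        exact oneParam_mul_comm (hs.bracket_right z hz _
          (b.sum_mem fun i _ ↦ b.smul_mem _ (hy i))) t 1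
      have h2 : (oneParam G z t)⁻¹ * expProd G y s = expProd G y s * (oneParam G z t)⁻¹ :=
        (Commute.inv_left (show Commute _ _ from h1)).eq
      simp only [mul_assoc, h2]
  refine modularCharacter_eq_one_of_conj hK hmem fun k ↦ ⟨fun hk ↦ ?_, hconj 1 k⟩
  have := hconj (-1) _ hk
  rw [oneParam_neg] at this
  simpa [mul_assoc] using this

/-- The span `W` of the `y - Ad (exp z) y`, with `z ∈ b` and `y ∈ u`, is in the kernel because the
modular character is a class function; on the `h`-orthogonal of `W` in `u`, every `Ad (exp z)` is
trivial, so its exponential is central. -/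
theorem modularCharacter_left [FiniteDimensional ℝ E] [ConnectedSpace G] [IsTopologicalGroup G]
    [LocallyCompactSpace G] {x : E} (hx : x ∈ u) : modularCharacter (oneParam G x 1) = 1 := by
  have hadd : ∀ y ∈ u, ∀ z ∈ u, modularCharacter (oneParam G (y + z) 1)
      = modularCharacter (oneParam G y 1) * modularCharacter (oneParam G z 1) := fun y hy z hz ↦ by
    rw [oneParam_add_vec (hs.bracket_left z hz y hy), map_mul]
  have hinv : ∀ g : G, modularCharacter g * modularCharacter g⁻¹ = 1 := fun g ↦ by
    rw [← map_mul, mul_inv_cancel, map_one]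
  have hconj : ∀ g k : G, modularCharacter (g * k * g⁻¹) = modularCharacter k := fun g k ↦ by
    rw [map_mul, map_mul, mul_right_comm, hinv, one_mul]
  let D : Set E := {w | ∃ z ∈ b, ∃ y ∈ u, w = y - adjointMap (oneParam G z 1) y}
  let W : Submodule ℝ E := Submodule.span ℝ D
  have hD : ∀ w ∈ D, w ∈ u := by
    rintro _ ⟨z, hz, y, hy, rfl⟩
    exact u.sub_mem hy (hs.adjointMap_mem hz hy 1)
  have hWu : W ≤ u := Submodule.span_le.2 hD
  have hne : ∀ g : G, modularCharacter g ≠ 0 := fun g ↦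
    left_ne_zero_of_mul_eq_one (hinv g)
  have hW : ∀ w ∈ W, ∀ c : ℝ, modularCharacter (oneParam G (c • w) 1) = 1 := by
    intro w hw
    induction hw using Submodule.span_induction with
    | mem w hw =>
      obtain ⟨z, hz, y, hy, rfl⟩ := hw
      intro c
      have hcy := u.smul_mem c hy
      have h1 := hadd (c • (y - adjointMap (oneParam G z 1) y))
        (u.smul_mem _ (u.sub_mem hy (hs.adjointMap_mem hz hy 1)))
        (adjointMap (oneParam G z 1) (c • y)) (hs.adjointMap_mem hz hcy 1)
      rw [map_smul, ← smul_add, sub_add_cancel, ← map_smul, ← conj_oneParam, hconj] at h1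
      exact (mul_eq_right₀ (hne _)).1 h1.symm
    | zero => intro c; rw [smul_zero, oneParam_zero_vec, map_one]
    | add v w hv hw ihv ihw =>
      intro c
      rw [smul_add, hadd _ (u.smul_mem _ (hWu hv)) _ (u.smul_mem _ (hWu hw)), ihv, ihw, one_mul]
    | smul a w hw ih => intro c; rw [smul_smul]; exact ih _
  let K : E →ₗ[ℝ] E →ₗ[ℝ] ℝ := LinearMap.mk₂ ℝ (fun x y ↦ h x y) (by simp) (by simp) (by simp)
    (by simp)
  obtain ⟨w, hw, hwo'⟩ := exists_orthogonal_decomposition (K := K) hs.symm hs.pos W x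
  have hwo : ∀ y ∈ W, h (x - w) y = 0 := hwo'
  have hxw : x - w ∈ u := u.sub_mem hx (hWu hw)
  -- the component orthogonal to `W` generates a central one-parameter subgroup
  have hfix : ∀ z ∈ b, adjointMap (oneParam G z 1) (x - w) = x - w := by
    intro z hz
    set a := adjointMap (oneParam G z 1) (x - w) with ha
    have h1 : h (x - w) (x - w - a) = 0 := hwo _ (Submodule.subset_span ⟨z, hz, _, hxw, rfl⟩)
    have h2 : h a a = h (x - w) (x - w) := hs.adjointMap_isometry hz 1 _ _
    have h3 : h (x - w - a) (x - w - a) = 0 := by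
      have h4 := hs.symm a (x - w)
      rw [map_sub (h (x - w))] at h1
      rw [map_sub h, sub_apply, map_sub (h (x - w)), map_sub (h a)]
      linarith
    exact (sub_eq_zero.1 (hs.eq_zero h3)).symm
  have hcen : Subgroup.centralizer {oneParam G (x - w) 1} = ⊤ := by
    refine hs.eq_top_of_mem _ (fun y hy ↦ ?_) fun z hz ↦ ?_
    · rw [Subgroup.mem_centralizer_singleton_iff]
      exact oneParam_mul_comm (hs.bracket_left _ hy _ hxw) 1 1
    · rw [Subgroup.mem_centralizer_singleton_iff]
      have := conj_oneParam (oneParam G z 1) (x - w) 1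
      rw [hfix z hz] at this
      exact mul_inv_eq_iff_eq_mul.1 this
  obtain ⟨K, hK, hK1⟩ := exists_compact_mem_nhds (1 : G)
  have h1 : modularCharacter (oneParam G (x - w) 1) = 1 := by
    have := t2Space_of_lieGroup E G
    refine modularCharacter_eq_one_of_conj hK hK1 fun k ↦ ?_
    have h2 : k ∈ Subgroup.centralizer {oneParam G (x - w) 1} := hcen ▸ Subgroup.mem_top k
    rw [Subgroup.mem_centralizer_singleton_iff] at h2
    rw [← h2, mul_inv_cancel_right]
  have h2 := hadd _ hxw _ (hWu hw)
  have h3 := hW w hw 1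
  rw [one_smul] at h3
  rw [sub_add_cancel, h1, h3, one_mul] at h2
  exact h2

theorem modularCharacter_eq_one [FiniteDimensional ℝ E] [ConnectedSpace G] [IsTopologicalGroup G]
    [LocallyCompactSpace G] (g : G) : modularCharacter g = 1 := by
  have h1 : (modularCharacter (G := G)).ker = ⊤ :=
    hs.eq_top_of_mem _ (fun x hx ↦ hs.modularCharacter_left hx) fun x hx ↦
      hs.modularCharacter_right hx
  have h2 : g ∈ (modularCharacter (G := G)).ker := h1 ▸ Subgroup.mem_top g
  exact h2

end IsFlatSplitting
end Splitting

/-! ### The Levi-Civita connection of a left-invariant metric -/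

/-- The covariant derivative `v ↦ ∇_v Y` at `x`, with tangent spaces replaced by the model space
they are definitionally equal to. -/
def covE {E : Type*} [NormedAddCommGroup E] [NormedSpace ℝ E] {M : Type*} [TopologicalSpace M]
    [ChartedSpace E M] [IsManifold 𝓘(ℝ, E) ∞ M]
    (cov : CovariantDerivative 𝓘(ℝ, E) E (TangentSpace 𝓘(ℝ, E) : M → Type _))
    (Y : M → E) (x : M) : E →L[ℝ] E := cov Y x

section LeftInvariantConnection

variable {E : Type*} [NormedAddCommGroup E] [NormedSpace ℝ E]
  {G : Type*} [TopologicalSpace G] [ChartedSpace E G] [Group G] [LieGroup 𝓘(ℝ, E) ∞ G]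

/-- The left-invariant vector field with value `x` at the identity. -/
def leftField (x : E) (g : G) : E := leftTranslate g x

/-- The metric at `g`, with tangent spaces replaced by the model space. -/
def metricForm (μ : LorentzianMetric 𝓘(ℝ, E) G) (g : G) : E →L[ℝ] E →L[ℝ] ℝ := μ.inner g

variable (cov : CovariantDerivative 𝓘(ℝ, E) E (TangentSpace 𝓘(ℝ, E) : G → Type _))
  {μ : LorentzianMetric 𝓘(ℝ, E) G}

theorem isSmoothVectorField_leftField (x : E) :
    IsSmoothVectorField (I := 𝓘(ℝ, E)) (M := G) (leftField x) :=
  contMDiff_leftTranslate x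

theorem mdifferentiableAt_leftField (x : E) (g : G) :
    MDifferentiableAt 𝓘(ℝ, E) 𝓘(ℝ, E).tangent
      (fun k : G ↦ (⟨k, leftField (E := E) x k⟩ : TangentBundle 𝓘(ℝ, E) G)) g :=
  (contMDiff_leftTranslate x).mdifferentiable (by simp) g

omit [LieGroup 𝓘(ℝ, E) ∞ G] in
theorem leftField_add (x y : E) : (leftField (x + y) : G → E) = leftField x + leftField y := by
  ext g; simp [leftField]

omit [LieGroup 𝓘(ℝ, E) ∞ G] in
theorem leftField_smul (c : ℝ) (x : E) : (leftField (c • x) : G → E) = c • leftField x := by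
  ext g; simp [leftField]

omit [LieGroup 𝓘(ℝ, E) ∞ G] in
theorem leftField_one (x : E) : leftField x (1 : G) = x := by
  simp [leftField, leftTranslate_one E G]

theorem covE_leftField_add (x y : E) (g : G) :
    covE cov (leftField (x + y)) g = covE cov (leftField x) g + covE cov (leftField y) g := by
  rw [leftField_add]
  exact cov.isCovariantDerivativeOnUniv.add (mdifferentiableAt_leftField x g)
    (mdifferentiableAt_leftField y g)

theorem covE_leftField_smul (c : ℝ) (x : E) (g : G) :
    covE cov (leftField (c • x)) g = c • covE cov (leftField x) g := by
  rw [leftField_smul]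
  exact cov.isCovariantDerivativeOnUniv.smul_const c (mdifferentiableAt_leftField x g)

theorem metricForm_leftField (hμ : μ.IsLeftInvariant) (x y : E) (g : G) :
    metricForm μ g (leftField x g) (leftField y g) = metricForm μ 1 x y := by
  have h := hμ g 1 x y
  have h1 : ∀ k : G, k = g → metricForm μ k (leftField x g) (leftField y g) = metricForm μ 1 x y →
    metricForm μ g (leftField x g) (leftField y g) = metricForm μ 1 x y := by
    rintro k rfl h; exact h
  exact h1 (g * 1) (mul_one g) h

theorem mvfderiv_metricForm_leftField (hμ : μ.IsLeftInvariant) (x y : E) (g : G) :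
    mvfderiv 𝓘(ℝ, E) (fun k : G ↦ metricForm μ k (leftField x k) (leftField y k)) g = 0 := by
  simp only [metricForm_leftField hμ]
  exact mvfderiv_const _

theorem covE_metric (hμ : μ.IsLeftInvariant) (h : μ.IsLeviCivita cov) (y z : E) (g : G) (v : E) :
    metricForm μ g (covE cov (leftField y) g v) (leftField z g)
      = - metricForm μ g (leftField y g) (covE cov (leftField z) g v) := by
  have h1 := h.2 (leftField y) (leftField z) (isSmoothVectorField_leftField y)
    (isSmoothVectorField_leftField z) g v
  have h2 := congrArg (fun f : E →L[ℝ] ℝ ↦ f v) (mvfderiv_metricForm_leftField hμ y z g)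
  have h3 := h1.symm.trans h2
  exact eq_neg_of_add_eq_zero_left h3

theorem metricForm_symm (g : G) (x y : E) : metricForm μ g x y = metricForm μ g y x :=
  μ.symm g x y

theorem eq_zero_of_metricForm {x : E} (hx : ∀ y, metricForm μ 1 x y = 0) : x = 0 := by
  obtain ⟨n, f, hf⟩ := μ.signature 1
  let f' : Module.Basis (Fin (n + 1)) ℝ E := f
  have hf' : ∀ i j, metricForm μ 1 (f' i) (f' j)
      = if i = j then (if i = 0 then -1 else 1) else 0 := hf
  rw [← f'.sum_repr x] at hx ⊢
  refine Finset.sum_eq_zero fun j _ ↦ ?_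
  have h1 := hx (f' j)
  simp only [map_sum, map_smul, sum_apply, smul_apply, hf', smul_eq_mul, mul_ite, mul_zero,
    Finset.sum_ite_eq', Finset.mem_univ, if_true] at h1
  have h2 : f'.repr x j = 0 := by split_ifs at h1 <;> simpa using h1
  rw [h2, zero_smul]

variable [CompleteSpace E]

theorem mlieBracket_leftField (x y : E) (g : G) :
    mlieBracket 𝓘(ℝ, E) (leftField x) (leftField y) g = leftField (groupBracket G x y) g :=
  (congrFun (mulInvariantVector_mlieBracket (I := 𝓘(ℝ, E)) (G := G) x y) g).symm

theorem covE_torsion (h : μ.IsLeviCivita cov) (x y : E) (g : G) :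
    covE cov (leftField y) g (leftField x g) - covE cov (leftField x) g (leftField y g)
      = leftField (groupBracket G x y) g :=
  (h.1 (leftField x) (leftField y) (isSmoothVectorField_leftField x)
    (isSmoothVectorField_leftField y) g).trans (mlieBracket_leftField x y g)

/-- The covariant derivative of left-invariant fields is left-invariant. This is the uniqueness part
of the Koszul argument: the product read off at `g` and the one read off at the identity are both
skew for the metric with the same torsion. -/
theorem covE_leftField (hμ : μ.IsLeftInvariant) (h : μ.IsLeviCivita cov) (x y : E) (g : G) :
    covE cov (leftField y) g (leftField x g) = leftField (covE cov (leftField y) 1 x) g := by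
  let D (x y : E) : E := (Equiv.ofBijective _ (leftTranslate_bijective (E := E) g)).symm
    (covE cov (leftField y) g (leftField x g))
  have hD : ∀ x y, leftField (D x y) g = covE cov (leftField y) g (leftField x g) := fun x y ↦
    (Equiv.ofBijective _ (leftTranslate_bijective (E := E) g)).apply_symm_apply _
  have hinj : ∀ v w : E, leftField v g = leftField w g → v = w := fun v w hvw ↦
    (leftTranslate_bijective (E := E) g).1 hvw
  have hD1 : ∀ x y z, metricForm μ 1 (D x y) z = - metricForm μ 1 y (D x z) := fun x y z ↦ by
    rw [← metricForm_leftField hμ _ _ g, ← metricForm_leftField hμ _ _ g, hD, hD]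
    exact covE_metric cov hμ h y z g _
  have hD2 : ∀ x y, D x y - D y x = groupBracket G x y := fun x y ↦ hinj _ _ <| by
    rw [← covE_torsion cov h x y g, ← hD, ← hD]
    exact map_sub (leftTranslate g) _ _
  have hL1 : ∀ x y z, metricForm μ 1 (covE cov (leftField y) 1 x) z
      = - metricForm μ 1 y (covE cov (leftField z) 1 x) := fun x y z ↦ by
    have := covE_metric cov hμ h y z 1 x
    rwa [leftField_one, leftField_one] at this
  have hL2 : ∀ x y, covE cov (leftField y) 1 x - covE cov (leftField x) 1 y
      = groupBracket G x y := fun x y ↦ by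
    have := covE_torsion cov h x y 1
    rwa [leftField_one, leftField_one, leftField_one] at this
  -- the difference of the two products is symmetric in its arguments and skew for the metric
  let S (x y z : E) : ℝ := metricForm μ 1 (D x y - covE cov (leftField y) 1 x) z
  have hS1 : ∀ x y z, S x y z = - S x z y := fun x y z ↦ by
    simp only [S, map_sub, sub_apply, hD1 x y, hL1 x y, metricForm_symm (1 : G) _ y]
    ring
  have hS2 : ∀ x y z, S x y z = S y x z := fun x y z ↦ by
    have h1 : D x y - covE cov (leftField y) 1 x = D y x - covE cov (leftField x) 1 y := by
      have h2 := (hD2 x y).trans (hL2 x y).symm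
      rw [sub_eq_sub_iff_add_eq_add] at h2 ⊢
      rw [h2, add_comm]
    simp only [S, h1]
  have hS : D x y - covE cov (leftField y) 1 x = 0 := by
    refine eq_zero_of_metricForm (μ := μ) fun z ↦ ?_
    have : S x y z = - S x y z := by
      conv_lhs => rw [hS1, hS2, hS1, hS2, hS1, hS2]
      simp
    change S x y z = 0
    linarith
  rw [← hD, sub_eq_zero.1 hS]

/-- The product `L x y = ∇_X Y` at the identity, where `X` and `Y` are the left-invariant fields
extending `x` and `y`. -/
def leftProduct : E →ₗ[ℝ] E →ₗ[ℝ] E :=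
  LinearMap.mk₂ ℝ (fun x y ↦ covE cov (leftField y) 1 x) (by simp) (by simp)
    (fun x y z ↦ by rw [covE_leftField_add, add_apply])
    (fun c x y ↦ by rw [covE_leftField_smul, smul_apply])

omit [CompleteSpace E] in
theorem leftProduct_skew (hμ : μ.IsLeftInvariant) (h : μ.IsLeviCivita cov) (x y z : E) :
    metricForm μ 1 (leftProduct cov x y) z = - metricForm μ 1 y (leftProduct cov x z) := by
  have := covE_metric cov hμ h y z 1 x
  rwa [leftField_one, leftField_one] at this

theorem leftProduct_torsion (h : μ.IsLeviCivita cov) (x y : E) :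
    leftProduct cov x y - leftProduct cov y x = groupBracket G x y := by
  have := covE_torsion cov h x y 1
  rwa [leftField_one, leftField_one, leftField_one] at this

theorem leftProduct_flat (hμ : μ.IsLeftInvariant) (h : μ.IsLeviCivita cov)
    (hc : CurvatureVanishes cov) (x y : E) :
    leftProduct cov (leftProduct cov x y - leftProduct cov y x)
      = leftProduct cov x ∘ₗ leftProduct cov y - leftProduct cov y ∘ₗ leftProduct cov x := by
  ext z
  have h1 := hc (leftField x) (leftField y) (leftField z) (isSmoothVectorField_leftField x)
    (isSmoothVectorField_leftField y) (isSmoothVectorField_leftField z) 1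
  have h2 : ∀ x : E, (fun k : G ↦ covE cov (leftField z) k (leftField x k))
      = leftField (leftProduct cov x z) := fun x ↦ funext fun k ↦ covE_leftField cov hμ h x z k
  have h3 : covE cov (fun k : G ↦ covE cov (leftField z) k (leftField y k)) 1 (leftField x (1 : G))
      - covE cov (fun k : G ↦ covE cov (leftField z) k (leftField x k)) 1 (leftField y (1 : G))
      - covE cov (leftField z) 1 (mlieBracket 𝓘(ℝ, E) (leftField x) (leftField y) (1 : G)) = 0 := h1
  rw [h2, h2, mlieBracket_leftField, leftField_one, leftField_one, leftField_one,
    ← leftProduct_torsion cov h] at h3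
  exact (sub_eq_zero.1 h3).symm

theorem leftProduct_killing (hμ : μ.IsLeftInvariant) (h : μ.IsLeviCivita cov) {x : E}
    (hx : μ.IsKilling (leftField x)) (y z : E) :
    metricForm μ 1 (leftProduct cov x y - leftProduct cov y x) z
      = - metricForm μ 1 y (leftProduct cov x z - leftProduct cov z x) := by
  rw [leftProduct_torsion cov h, leftProduct_torsion cov h]
  have h1 := hx.2 (leftField y) (leftField z) (isSmoothVectorField_leftField y)
    (isSmoothVectorField_leftField z) 1
  have h2 := congrArg (fun f : E →L[ℝ] ℝ ↦ f (leftField x (1 : G)))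
    (mvfderiv_metricForm_leftField hμ y z 1)
  have h3 : metricForm μ 1 (groupBracket G x y) (leftField z (1 : G))
      + metricForm μ 1 (leftField y (1 : G)) (groupBracket G x z) = 0 := h1.symm.trans h2
  rw [leftField_one, leftField_one] at h3
  exact eq_neg_of_add_eq_zero_left h3

omit [LieGroup 𝓘(ℝ, E) ∞ G] [CompleteSpace E] in
theorem eq_leftField {X : Π x : G, TangentSpace 𝓘(ℝ, E) x} (hX : IsLeftInvariantVectorField X) :
    X = leftField (E := E) (X 1) := by
  funext g
  have h1 : ∀ k : G, k = g → leftField (E := E) (X 1) g = (X k : E) →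
    (X g : E) = leftField (E := E) (X 1) g := by rintro k rfl h; exact h.symm
  exact h1 (g * 1) (mul_one g) (hX g 1)

/-- The kernel of the product and its orthogonal, for the inner product obtained from the timelike
Killing field. -/
theorem exists_isFlatSplitting [FiniteDimensional ℝ E] (hμ : μ.IsLeftInvariant)
    (h : μ.IsLeviCivita cov) (hc : CurvatureVanishes cov)
    (hX : ∃ X : Π x : G, TangentSpace 𝓘(ℝ, E) x,
      IsLeftInvariantVectorField X ∧ μ.IsKilling X ∧ μ.IsTimelike X) :
    ∃ (k : E →L[ℝ] E →L[ℝ] ℝ) (b : Submodule ℝ E),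
      IsFlatSplitting G k (LinearMap.ker (leftProduct cov)) b ∧
      ∀ x ∈ b, ∀ y ∈ b, leftProduct cov x y = 0 := by
  obtain ⟨X, hX1, hX2, hX3⟩ := hX
  rw [eq_leftField hX1] at hX2
  let B : E →ₗ[ℝ] E →ₗ[ℝ] ℝ := LinearMap.mk₂ ℝ (fun x y ↦ metricForm μ 1 x y) (by simp) (by simp)
    (by simp) (by simp)
  obtain ⟨n, f, hf⟩ := μ.signature 1
  let f' : Module.Basis (Fin (n + 1)) ℝ E := f
  have hf' : ∀ i j, B (f' i) (f' j) = if i = j then (if i = 0 then -1 else 1) else 0 := hf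
  have hx₀ : B (X 1) (X 1) < 0 := hX3 1
  set L := leftProduct cov
  obtain ⟨k, ksymm, kpos, kskew⟩ := exists_posDef_of_timelike B (metricForm_symm 1) L
    (leftProduct_skew cov hμ h) (leftProduct_flat cov hμ h hc) hx₀
    (fun v hv hv0 ↦ pos_of_orthogonal_timelike hf' hx₀ hv hv0) (leftProduct_killing cov hμ h hX2)
  let b : Submodule ℝ E :=
    { carrier := {x | ∀ u, L u = 0 → k u x = 0}
      add_mem' := fun hx hy u hu ↦ by rw [map_add, hx u hu, hy u hu, add_zero]
      zero_mem' := fun u _ ↦ map_zero _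
      smul_mem' := fun c x hx u hu ↦ by rw [map_smul, hx u hu, smul_zero] }
  have hb : ∀ x ∈ b, ∀ y ∈ b, L x y = 0 := fun x hx y hy ↦
    flat_mul_eq_zero k ksymm kpos L kskew (leftProduct_flat cov hμ h hc) hx hy
  have hsup : LinearMap.ker L ⊔ b = ⊤ := by
    refine eq_top_iff.2 fun v _ ↦ ?_
    obtain ⟨w, hw, hwo⟩ := exists_orthogonal_decomposition ksymm kpos (LinearMap.ker L) v
    exact Submodule.mem_sup.2 ⟨w, hw, v - w, fun u hu ↦ (ksymm _ _).trans (hwo u hu),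
      add_sub_cancel _ _⟩
  -- on `b` the adjoint representation is left multiplication
  have had : ∀ x ∈ b, ∀ y, groupBracket G x y = L x y := fun x hx y ↦ by
    obtain ⟨p, hp, q, hq, rfl⟩ := Submodule.mem_sup.1 (hsup ▸ Submodule.mem_top :
      y ∈ LinearMap.ker L ⊔ b)
    rw [← leftProduct_torsion cov h, sub_eq_self, map_add, LinearMap.add_apply, hb q hq x hx,
      LinearMap.mem_ker.1 hp, LinearMap.zero_apply, add_zero]
  let K : E →L[ℝ] E →L[ℝ] ℝ :=
    LinearMap.toContinuousLinearMap (LinearMap.toContinuousLinearMap.toLinearMap ∘ₗ k)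
  refine ⟨K, b, ?_, hb⟩
  exact
  { symm := ksymm
    pos := kpos
    bracket_left := fun x hx y hy ↦ by
      rw [← leftProduct_torsion cov h, LinearMap.mem_ker.1 hx, LinearMap.mem_ker.1 hy]
      simp
    bracket_right := fun x hx y hy ↦ by rw [had x hx, hb x hx y hy]
    skew := fun x hx y z ↦ by
      rw [had x hx, had x hx]
      exact kskew x y z
    ortho := fun x hx y hy ↦ hy x hx
    sup_eq_top := hsup }

end LeftInvariantConnection

/-! ### Covariant derivatives in the frame of a chart -/

section CovariantDerivativeInFrame

variable {E : Type*} [NormedAddCommGroup E] [NormedSpace ℝ E]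
  {M : Type*} [TopologicalSpace M] [ChartedSpace E M] [IsManifold 𝓘(ℝ, E) ∞ M]

/-- The vector field with constant components `w` in the coordinate frame of the preferred chart
at `p`; it is zero outside the domain of the frame. -/
def frameField (p : M) (w : E) (x : M) : E :=
  (trivializationAt E (TangentSpace 𝓘(ℝ, E) : M → Type _) p).symmL ℝ x w

/-- The components of the tangent vector `v` at `x` in the coordinate frame of the preferred chart
at `p`. -/
def frameCoord (p x : M) (v : E) : E :=
  (trivializationAt E (TangentSpace 𝓘(ℝ, E) : M → Type _) p
    (⟨x, v⟩ : TangentBundle 𝓘(ℝ, E) M)).2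

theorem frameField_eq_symm {p x : M}
    (hx : x ∈ (trivializationAt E (TangentSpace 𝓘(ℝ, E) : M → Type _) p).baseSet) (w : E) :
    frameField p w x = (trivializationAt E (TangentSpace 𝓘(ℝ, E) : M → Type _) p).symm x w :=
  (trivializationAt E (TangentSpace 𝓘(ℝ, E) : M → Type _) p).symmL_apply hx w

theorem frameField_add (p : M) (v w : E) :
    (frameField p (v + w) : M → E) = frameField p v + frameField p w :=
  funext fun x ↦ map_add ((trivializationAt E (TangentSpace 𝓘(ℝ, E) : M → Type _) p).symmL ℝ x) v w

theorem frameField_smul (p : M) (c : ℝ) (w : E) :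
    (frameField p (c • w) : M → E) = c • frameField p w :=
  funext fun x ↦ map_smul ((trivializationAt E (TangentSpace 𝓘(ℝ, E) : M → Type _) p).symmL ℝ x) c w

theorem eventually_mem_baseSet (p : M) : ∀ᶠ x in 𝓝 p,
    x ∈ (trivializationAt E (TangentSpace 𝓘(ℝ, E) : M → Type _) p).baseSet :=
  (trivializationAt E (TangentSpace 𝓘(ℝ, E) : M → Type _) p).open_baseSet.mem_nhds
    (FiberBundle.mem_baseSet_trivializationAt' p)

theorem frameCoord_frameField {p x : M}
    (hx : x ∈ (trivializationAt E (TangentSpace 𝓘(ℝ, E) : M → Type _) p).baseSet) (w : E) :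
    frameCoord p x (frameField p w x) = w :=
  (congrArg (frameCoord p x) (frameField_eq_symm hx w)).trans <| congrArg Prod.snd
    ((trivializationAt E (TangentSpace 𝓘(ℝ, E) : M → Type _) p).apply_mk_symm hx w)

theorem frameField_frameCoord {p x : M}
    (hx : x ∈ (trivializationAt E (TangentSpace 𝓘(ℝ, E) : M → Type _) p).baseSet) (v : E) :
    frameField p (frameCoord p x v) x = v :=
  (frameField_eq_symm hx _).trans <|
    (trivializationAt E (TangentSpace 𝓘(ℝ, E) : M → Type _) p).symm_apply_apply_mk hx v

theorem frameCoord_eq {p x : M}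
    (hx : x ∈ (trivializationAt E (TangentSpace 𝓘(ℝ, E) : M → Type _) p).baseSet) (v : E) :
    frameCoord p x v
      = (trivializationAt E (TangentSpace 𝓘(ℝ, E) : M → Type _) p).linearMapAt ℝ x v :=
  (congrFun ((trivializationAt E (TangentSpace 𝓘(ℝ, E) : M → Type _) p).coe_linearMapAt_of_mem hx)
    v).symm

theorem frameCoord_add {p x : M}
    (hx : x ∈ (trivializationAt E (TangentSpace 𝓘(ℝ, E) : M → Type _) p).baseSet) (v w : E) :
    frameCoord p x (v + w) = frameCoord p x v + frameCoord p x w := by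
  simp only [frameCoord_eq hx]
  exact map_add ((trivializationAt E (TangentSpace 𝓘(ℝ, E) : M → Type _) p).linearMapAt ℝ x) v w

theorem frameCoord_sum {ι : Type*} (s : Finset ι) {p x : M}
    (hx : x ∈ (trivializationAt E (TangentSpace 𝓘(ℝ, E) : M → Type _) p).baseSet)
    (c : ι → ℝ) (v : ι → E) :
    frameCoord p x (∑ i ∈ s, c i • v i) = ∑ i ∈ s, c i • frameCoord p x (v i) := by
  let A : E →ₗ[ℝ] E := (trivializationAt E (TangentSpace 𝓘(ℝ, E) : M → Type _) p).linearMapAt ℝ x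
  have hA : ∀ v, frameCoord p x v = A v := frameCoord_eq hx
  simp only [hA, map_sum, map_smul]

theorem mdifferentiableAt_iff_frameCoord {p : M} (Y : M → E) :
    MDifferentiableAt 𝓘(ℝ, E) 𝓘(ℝ, E).tangent (fun x ↦ (⟨x, Y x⟩ : TangentBundle 𝓘(ℝ, E) M)) p ↔
      MDifferentiableAt 𝓘(ℝ, E) 𝓘(ℝ, E) (fun x ↦ frameCoord p x (Y x)) p :=
  mdifferentiableAt_section (IB := 𝓘(ℝ, E)) (F := E) (E := (TangentSpace 𝓘(ℝ, E) : M → Type _)) Y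

theorem mdifferentiableAt_frameField {p : M} {F : M → E}
    (hF : MDifferentiableAt 𝓘(ℝ, E) 𝓘(ℝ, E) F p) :
    MDifferentiableAt 𝓘(ℝ, E) 𝓘(ℝ, E).tangent
      (fun x ↦ (⟨x, frameField (E := E) p (F x) x⟩ : TangentBundle 𝓘(ℝ, E) M)) p := by
  rw [mdifferentiableAt_iff_frameCoord]
  refine hF.congr_of_eventuallyEq ?_
  filter_upwards [eventually_mem_baseSet (E := E) p] with x hx
  exact frameCoord_frameField (E := E) hx _

theorem eventually_constExtension_eq (p : M) (v : E) :
    ∀ᶠ x in 𝓝 p, (constExtension (I := 𝓘(ℝ, E)) (p := p) v x : E)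
      = frameField p (frameCoord p p v) x := by
  filter_upwards [eventually_mem_baseSet (E := E) p] with x hx
  exact (frameField_eq_symm hx _).symm

variable (cov : CovariantDerivative 𝓘(ℝ, E) E (TangentSpace 𝓘(ℝ, E) : M → Type _))

omit [IsManifold 𝓘(ℝ, E) ∞ M] in
theorem tangentDeriv_add {p : M} {F F' : M → E} (hF : MDifferentiableAt 𝓘(ℝ, E) 𝓘(ℝ, E) F p)
    (hF' : MDifferentiableAt 𝓘(ℝ, E) 𝓘(ℝ, E) F' p) :
    tangentDeriv E E (F + F') p = tangentDeriv E E F p + tangentDeriv E E F' p :=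
  mfderiv_add hF hF'

omit [IsManifold 𝓘(ℝ, E) ∞ M] in
theorem tangentDeriv_smul_const {p : M} {f : M → ℝ} (hf : MDifferentiableAt 𝓘(ℝ, E) 𝓘(ℝ, ℝ) f p)
    (w : E) :
    tangentDeriv E E (fun x ↦ f x • w) p = (tangentDeriv E ℝ f p).smulRight w := by
  have h1 : (fun x ↦ f x • w) = (ContinuousLinearMap.toSpanSingleton ℝ w) ∘ f := by ext; simp
  rw [h1, tangentDeriv_comp (E' := ℝ)
    (ContinuousLinearMap.differentiableAt _).mdifferentiableAt hf, tangentDeriv_eq_fderiv,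
    ContinuousLinearMap.fderiv]
  ext v
  simp

/-- `constExtension` and `frameField` agree on the domain of the frame only, which is enough by
locality. -/
theorem covE_constExtension (p : M) (v : E) :
    covE cov (constExtension (I := 𝓘(ℝ, E)) (p := p) v) p
      = covE cov (frameField p (frameCoord p p v)) p := by
  have h1 := eventually_constExtension_eq p v
  have h2 : MDifferentiableAt 𝓘(ℝ, E) 𝓘(ℝ, E).tangent
      (fun x ↦ (⟨x, frameField (E := E) p (frameCoord p p v) x⟩ : TangentBundle 𝓘(ℝ, E) M)) p :=
    mdifferentiableAt_frameField (F := fun _ ↦ frameCoord p p v) mdifferentiableAt_const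
  refine cov.isCovariantDerivativeOnUniv.congr_of_eventuallyEq ?_ h2 univ_mem h1
  refine h2.congr_of_eventuallyEq ?_
  filter_upwards [h1] with x hx
  exact congrArg (fun w : E ↦ (⟨x, w⟩ : TangentBundle 𝓘(ℝ, E) M)) hx

/-- The Leibniz rule for `∑ F^k ∂_k`, with `F` the vector of components. -/
theorem covE_frameField [FiniteDimensional ℝ E] {p : M} {F : M → E}
    (hF : MDifferentiableAt 𝓘(ℝ, E) 𝓘(ℝ, E) F p) (v : E) :
    covE cov (fun x ↦ frameField p (F x) x) p v
      = frameField p (tangentDeriv E E F p v) p + covE cov (frameField p (F p)) p v := by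
  let P : (M → E) → Prop := fun F ↦ MDifferentiableAt 𝓘(ℝ, E) 𝓘(ℝ, E) F p ∧
    covE cov (fun x ↦ frameField p (F x) x) p v
      = frameField p (tangentDeriv E E F p v) p + covE cov (frameField p (F p)) p v
  have hconst : ∀ w : E, MDifferentiableAt 𝓘(ℝ, E) 𝓘(ℝ, E).tangent
      (fun x ↦ (⟨x, frameField (E := E) p w x⟩ : TangentBundle 𝓘(ℝ, E) M)) p := fun w ↦
    mdifferentiableAt_frameField (F := fun _ ↦ w) mdifferentiableAt_const
  have hadd : ∀ F F', P F → P F' → P (F + F') := by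
    rintro F F' ⟨hF, h⟩ ⟨hF', h'⟩
    refine ⟨hF.add hF', ?_⟩
    have h1 : (fun x ↦ frameField p ((F + F') x) x)
        = (fun x ↦ frameField p (F x) x) + (fun x ↦ frameField p (F' x) x) :=
      funext fun x ↦ congrFun (frameField_add p (F x) (F' x)) x
    have h2 : covE cov ((fun x ↦ frameField p (F x) x) + (fun x ↦ frameField p (F' x) x)) p
        = covE cov (fun x ↦ frameField p (F x) x) p + covE cov (fun x ↦ frameField p (F' x) x) p :=
      cov.isCovariantDerivativeOnUniv.add (mdifferentiableAt_frameField hF)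
        (mdifferentiableAt_frameField hF')
    have h3 : covE cov (frameField p (F p) + frameField p (F' p)) p
        = covE cov (frameField p (F p)) p + covE cov (frameField p (F' p)) p :=
      cov.isCovariantDerivativeOnUniv.add (hconst _) (hconst _)
    rw [h1, h2, tangentDeriv_add hF hF', Pi.add_apply, frameField_add p (F p), h3, add_apply,
      add_apply, add_apply, frameField_add, Pi.add_apply, h, h']
    abel
  have hsmul : ∀ (f : M → ℝ) (w : E), MDifferentiableAt 𝓘(ℝ, E) 𝓘(ℝ, ℝ) f p →
      P (fun x ↦ f x • w) := by
    intro f w hf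
    refine ⟨hf.smul mdifferentiableAt_const, ?_⟩
    have h1 : (fun x ↦ frameField p (f x • w) x) = f • frameField p w :=
      funext fun x ↦ congrFun (frameField_smul p (f x) w) x
    have h2 : covE cov (f • frameField p w) p
        = f p • covE cov (frameField p w) p + (tangentDeriv E ℝ f p).smulRight (frameField p w p) :=
      cov.isCovariantDerivativeOnUniv.leibniz (hconst w) hf
    have h3 : covE cov (f p • frameField p w) p = f p • covE cov (frameField p w) p :=
      cov.isCovariantDerivativeOnUniv.smul_const _ (hconst w)
    rw [h1, h2, frameField_smul, h3, tangentDeriv_smul_const hf, add_apply,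
      ContinuousLinearMap.smulRight_apply, ContinuousLinearMap.smulRight_apply, frameField_smul,
      add_comm]
    rfl
  let β := Module.finBasis ℝ E
  have hsum : ∀ s : Finset (Fin (Module.finrank ℝ E)),
      P (∑ i ∈ s, fun x ↦ β.repr (F x) i • β i) := by
    intro s
    induction s using Finset.induction_on with
    | empty =>
      have := hsmul (fun _ ↦ 0) 0 mdifferentiableAt_const
      simpa [Pi.zero_def] using this
    | insert i s hi ih =>
      rw [Finset.sum_insert hi]
      refine hadd _ _ (hsmul _ _ ?_) ih
      exact MDifferentiableAt.comp (I' := 𝓘(ℝ, E)) p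
        ((LinearMap.toContinuousLinearMap (β.coord i)).differentiableAt.mdifferentiableAt) hF
  have h1 := (hsum Finset.univ).2
  have h2 : (∑ i, fun x ↦ β.repr (F x) i • β i) = F := by
    ext x
    rw [Finset.sum_apply, β.sum_repr]
  rwa [h2] at h1

theorem covE_eq_frame [FiniteDimensional ℝ E] {p : M} {Y : M → E}
    (hY : MDifferentiableAt 𝓘(ℝ, E) 𝓘(ℝ, E).tangent
      (fun x ↦ (⟨x, Y x⟩ : TangentBundle 𝓘(ℝ, E) M)) p) (v : E) :
    covE cov Y p v = frameField p (tangentDeriv E E (fun x ↦ frameCoord p x (Y x)) p v) p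
      + covE cov (frameField p (frameCoord p p (Y p))) p v := by
  have hF := (mdifferentiableAt_iff_frameCoord Y).1 hY
  rw [← covE_frameField cov hF]
  have h1 : covE cov Y p = covE cov (fun x ↦ frameField p (frameCoord p x (Y x)) x) p := by
    refine cov.isCovariantDerivativeOnUniv.congr_of_eventuallyEq hY
      (mdifferentiableAt_frameField hF) univ_mem ?_
    filter_upwards [eventually_mem_baseSet (E := E) p] with x hx
    exact (frameField_frameCoord hx _).symm
  rw [h1]

end CovariantDerivativeInFrame

/-! ### Geodesics of a left-invariant metric -/

section Geodesics

variable {E : Type*} [NormedAddCommGroup E] [NormedSpace ℝ E]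
  {G : Type*} [TopologicalSpace G] [ChartedSpace E G] [Group G] [LieGroup 𝓘(ℝ, E) ∞ G]
  (cov : CovariantDerivative 𝓘(ℝ, E) E (TangentSpace 𝓘(ℝ, E) : G → Type _))

omit [Group G] [LieGroup 𝓘(ℝ, E) ∞ G] in
theorem velocity_eq {γ : ℝ → G} {v : E} {t : ℝ} (h : HasVelocityAt γ v t) :
    velocity 𝓘(ℝ, E) γ t = v := by
  have h1 : (mfderiv 𝓘(ℝ, ℝ) 𝓘(ℝ, E) γ t : ℝ →L[ℝ] E) = (1 : ℝ →L[ℝ] ℝ).smulRight v :=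
    HasMFDerivAt.mfderiv h
  have h2 := congrArg (fun f : ℝ →L[ℝ] E ↦ f 1) h1
  exact Eq.trans h2 (one_smul ℝ v)

/-- The covariant derivative along `γ` in the left-invariant frame:
`D/dt (ξ t)_{γ t} = (ξ' t)_{γ t} + ∇_{γ' t} (ξ t)`, where `ξ t` on the right is
extended to a left-invariant vector field. -/
theorem covDerivAlong_leftField [FiniteDimensional ℝ E] {γ : ℝ → G} {ξ : ℝ → E} {ξ' v : E} {t : ℝ}
    (hγ : HasVelocityAt γ v t) (hξ : HasDerivAt ξ ξ' t) :
    covDerivAlong cov γ (fun s ↦ leftField (E := E) (ξ s) (γ s)) t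
      = leftField ξ' (γ t) + covE cov (leftField (ξ t)) (γ t) v := by
  set p := γ t with hp
  let F (x : E) (g : G) : E := frameCoord p g (leftField x g)
  have hF : ∀ x, MDifferentiableAt 𝓘(ℝ, E) 𝓘(ℝ, E) (F x) p := fun x ↦
    (mdifferentiableAt_iff_frameCoord _).1 (mdifferentiableAt_leftField x p)
  have hFγ : ∀ x, HasDerivAt (fun s ↦ F x (γ s)) (tangentDeriv E E (F x) p v) t := fun x ↦
    hasVelocityAt_iff_hasDerivAt.1 (hγ.comp (hF x))
  -- `ξ s` is `ξ t` plus the remainder `∑ c i s • β i`, whose coefficients vanish at `s = t`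
  let β := Module.finBasis ℝ E
  let c (i : Fin (Module.finrank ℝ E)) (s : ℝ) : ℝ := β.repr (ξ s - ξ t) i
  have hc : ∀ i, HasDerivAt (c i) (β.repr ξ' i) t := fun i ↦
    (LinearMap.toContinuousLinearMap (β.coord i)).hasFDerivAt.comp_hasDerivAt t
      (hξ.sub_const (ξ t))
  have hc0 : ∀ i, c i t = 0 := fun i ↦ by simp [c]
  have hd : HasDerivAt (fun s ↦ frameCoord p (γ s) (leftField (ξ s) (γ s)))
      (tangentDeriv E E (F (ξ t)) p v + ∑ i, β.repr ξ' i • F (β i) p) t := by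
    have h1 := (hFγ (ξ t)).add (HasDerivAt.fun_sum (u := Finset.univ)
      fun i _ ↦ (hc i).smul (hFγ (β i)))
    simp only [hc0, zero_smul, zero_add] at h1
    refine h1.congr_of_eventuallyEq ?_
    have h2 : ContinuousAt γ t := HasMFDerivAt.continuousAt hγ
    filter_upwards [h2.eventually (eventually_mem_baseSet (E := E) p)] with s hs
    have h3 : leftField (ξ s) (γ s)
        = leftField (ξ t) (γ s) + ∑ i, c i s • leftField (β i) (γ s) := by
      have h4 : ∑ i, c i s • leftField (β i) (γ s) = leftField (∑ i, c i s • β i) (γ s) := by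
        simp only [leftField, map_sum, map_smul]
      rw [h4, β.sum_repr]
      simp [leftField]
    rw [h3, frameCoord_add hs, frameCoord_sum _ hs]
    rfl
  have hmem := FiberBundle.mem_baseSet_trivializationAt' (F := E)
    (E := (TangentSpace 𝓘(ℝ, E) : G → Type _)) p
  have h0 : covDerivAlong cov γ (fun s ↦ leftField (E := E) (ξ s) (γ s)) t
      = frameField p (deriv (fun s ↦ frameCoord p (γ s) (leftField (ξ s) (γ s))) t) p
        + covE cov (frameField p (frameCoord p p (leftField (ξ t) p))) p
          (velocity 𝓘(ℝ, E) γ t) := by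
    rw [frameField_eq_symm hmem, ← covE_constExtension cov]
    rfl
  have h1 : frameField p (∑ i, β.repr ξ' i • F (β i) p) p = leftField ξ' p := by
    have h2 := frameCoord_sum Finset.univ hmem (fun i ↦ β.repr ξ' i) (fun i ↦ leftField (β i) p)
    have h3 : ∑ i, β.repr ξ' i • F (β i) p
      = frameCoord p p (∑ i, β.repr ξ' i • leftField (β i) p) := h2.symm
    rw [h3, frameField_frameCoord hmem]
    have h4 : leftField ξ' p = leftField (∑ i, β.repr ξ' i • β i) p := by rw [β.sum_repr]
    rw [h4]
    simp only [leftField, map_sum, map_smul]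
  rw [h0, hd.deriv, velocity_eq hγ, covE_eq_frame cov (mdifferentiableAt_leftField (ξ t) p) v,
    frameField_add, Pi.add_apply, h1]
  simp only [F]
  abel

end Geodesics

section Completeness

variable {E : Type*} [NormedAddCommGroup E] [NormedSpace ℝ E] [FiniteDimensional ℝ E]
  {G : Type*} [TopologicalSpace G] [ChartedSpace E G] [Group G] [LieGroup 𝓘(ℝ, E) ∞ G]
  {cov : CovariantDerivative 𝓘(ℝ, E) E (TangentSpace 𝓘(ℝ, E) : G → Type _)}
  {μ : LorentzianMetric 𝓘(ℝ, E) G}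

/-- The geodesic equation in terms of the left logarithmic derivative: `ξ' = - L ξ ξ`. -/
theorem covDerivAlong_velocity_eq_zero [CompleteSpace E] (hμ : μ.IsLeftInvariant)
    (h : μ.IsLeviCivita cov)
    {γ : ℝ → G} {ξ : ℝ → E} (hγ : ∀ t, HasLeftDerivAt γ (ξ t) t)
    (hξ : ∀ t, HasDerivAt ξ (- leftProduct cov (ξ t) (ξ t)) t) (t : ℝ) :
    covDerivAlong cov γ (velocity 𝓘(ℝ, E) γ) t = 0 := by
  have h1 : velocity 𝓘(ℝ, E) γ = fun s ↦ leftField (E := E) (ξ s) (γ s) :=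
    funext fun s ↦ velocity_eq (hγ s)
  rw [h1]
  refine (covDerivAlong_leftField cov (hγ t) (hξ t)).trans ?_
  have h2 := covE_leftField cov hμ h (ξ t) (ξ t) (γ t)
  have h3 : leftField (-(leftProduct cov) (ξ t) (ξ t)) (γ t)
      = - leftField (covE cov (leftField (ξ t)) 1 (ξ t)) (γ t) := map_neg (leftTranslate (γ t)) _
  refine Eq.trans ?_ (neg_add_cancel (covE cov (leftField (ξ t)) (γ t) (leftField (ξ t) (γ t))))
  rw [h3, ← h2]
  rfl

/-- The geodesic with initial velocity the left translate of `x + y`, with `x ∈ ker L` and `y ∈ b`,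
is `p exp (t x) exp (t y)`. -/
theorem isGeodesicallyComplete_of_isFlatSplitting [CompleteSpace E] (hμ : μ.IsLeftInvariant)
    (h : μ.IsLeviCivita cov)
    {k : E →L[ℝ] E →L[ℝ] ℝ} {b : Submodule ℝ E}
    (hs : IsFlatSplitting G k (LinearMap.ker (leftProduct cov)) b)
    (hb : ∀ x ∈ b, ∀ y ∈ b, leftProduct cov x y = 0) : μ.IsGeodesicallyComplete := by
  intro p v
  obtain ⟨w, hw⟩ := (leftTranslate_bijective (E := E) p).2 v
  obtain ⟨x, hx, y, hy, rfl⟩ := Submodule.mem_sup.1 (hs.sup_eq_top ▸ Submodule.mem_top :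
    w ∈ LinearMap.ker (leftProduct cov) ⊔ b)
  let γ : ℝ → G := fun t ↦ p * (oneParam G x t * oneParam G y t)
  let ξ : ℝ → E := fun t ↦ adjointMap (oneParam G y (-t)) x + y
  have hγ : ∀ t, HasLeftDerivAt γ (ξ t) t := fun t ↦ by
    have h1 := ((hasLeftDerivAt_oneParam G x t).mul (hasLeftDerivAt_oneParam G y t)).mul_left p
    rwa [← oneParam_neg] at h1
  have hξ : ∀ t, HasDerivAt ξ (- leftProduct cov (ξ t) (ξ t)) t := fun t ↦ by
    have h1 := ((hasDerivAt_adjointMap_oneParam G y x (-t)).scomp t (hasDerivAt_neg t)).add_const y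
    refine h1.congr_deriv ?_
    have h2 : leftProduct cov (adjointMap (oneParam G y (-t)) x) = 0 := hs.adjointMap_mem hy hx (-t)
    rw [neg_one_smul, ← leftProduct_torsion cov h]
    simp only [ξ, map_add, LinearMap.add_apply, h2, LinearMap.zero_apply, hb y hy y hy]
    simp
  refine ⟨γ, ⟨?_, cov, h, covDerivAlong_velocity_eq_zero hμ h hγ hξ⟩, ?_⟩
  · exact contMDiff_const.mul ((contMDiff_oneParam x).mul (contMDiff_oneParam y))
  · have h0 : γ 0 = p := by simp [γ, oneParam_zero]
    have h1 : ξ 0 = x + y := by simp [ξ, oneParam_zero, adjointMap_one]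
    have h2 : (⟨γ 0, velocity 𝓘(ℝ, E) γ 0⟩ : TangentBundle 𝓘(ℝ, E) G)
        = ⟨γ 0, leftTranslate (E := E) (γ 0) (ξ 0)⟩ :=
      congrArg (fun w : E ↦ (⟨γ 0, w⟩ : TangentBundle 𝓘(ℝ, E) G)) (velocity_eq (hγ 0))
    rw [h2, h0, h1]
    exact congrArg (fun w : E ↦ (⟨p, w⟩ : TangentBundle 𝓘(ℝ, E) G)) hw

end Completeness

end

theorem corollary1 {E : Type*} [NormedAddCommGroup E] [NormedSpace ℝ E] [FiniteDimensional ℝ E]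
    {G : Type*} [TopologicalSpace G] [ChartedSpace E G] [Group G] [LieGroup 𝓘(ℝ, E) ∞ G]
    [ConnectedSpace G]
    (μ : LorentzianMetric 𝓘(ℝ, E) G) (hμ : μ.IsLeftInvariant) (hflat : μ.IsFlat)
    (hX : ∃ X : Π x : G, TangentSpace 𝓘(ℝ, E) x,
      IsLeftInvariantVectorField X ∧ μ.IsKilling X ∧ μ.IsTimelike X) :
    derivedSeries G 2 = ⊥ ∧ IsUnimodularLieGroup 𝓘(ℝ, E) G ∧ μ.IsGeodesicallyComplete := by
  have : CompleteSpace E := FiniteDimensional.complete ℝ E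
  obtain ⟨cov, hcov, hcurv⟩ := hflat
  obtain ⟨k, b, hs, hb⟩ := exists_isFlatSplitting cov hμ hcov hcurv hX
  refine ⟨hs.derivedSeries_two_eq_bot, fun g ↦ ?_,
    isGeodesicallyComplete_of_isFlatSplitting hμ hcov hs hb⟩
  have : IsTopologicalGroup G := topologicalGroup_of_lieGroup 𝓘(ℝ, E) ∞
  have : LocallyCompactSpace G := Manifold.locallyCompact_of_finiteDimensional 𝓘(ℝ, E)
  exact hs.modularCharacter_eq_one g
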